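/- Let $\mu$ be a measure on $\mathbb R$, let $g$ and $h_\gamma$ ($\gamma\in\Gamma$, with $\emptyset\ne\Gamma\subset\mathbb R^{d}$) be probability densities with respect to $\mu$, and let the laws with densities $g$ and $h_\gamma$ be mutually absolutely continuous. Write $P_f$ and $E_f$ for probability and expectation when $X, X_1,X_2,\dots$ are i.i.d. with density $f$, and let $l_\gamma(x)=\log h_\gamma(x)-\log g(x)$. Assume: (A1) $\min_{\gamma\in\Gamma}E_g\{\log g(X)-\log h_\gamma(X)\}>0$ (the expectations may be $+\infty$). (A2) $\Gamma$ is compact with continuously differentiable boundary: near each boundary point $p$, $\Gamma$ coincides with $\{\varphi\le 0\}$ for some $C^1$ function $\varphi$ with $\varphi(p)=0$, $\nabla\varphi(p)\neq0$. (A3) Almost surely, $h_\gamma(X)>0$ for all $\gamma\in\Gamma$ and $\gamma\mapsto l_\gamma(X)$ is differentiable on $\Gamma$; and for $S=\sup_{\gamma\in\Gamma}|\nabla_\gamma l_\gamma(X)|$ there are $\eta>0$ and $x_0\ge 1$ such that for all $x>x_0$ $$\sup_{\gamma\in\Gamma}\max\{P_g(S>x),P_{h_\gamma}(S>x)\}\le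 e^{-(\log x)^{1+\eta}}.$$ For densities $g,h$ put $M_g(z)=\int (h/g)^z g\,d\mu$, $m_g(t)=\sup_{z\in\mathbb R}[zt-\log M_g(z)]$, let $M_h,m_h$ be the same with the roles of $g$ and $h$ exchanged, and define the Chernoff index of $g$ and $h$ as the supremum of $\min\{m_g(t),m_h(-t)\}$ over all real $t$ with $E_g(l)<t<E_h(l)$, where $l=\log h(X)-\log g(X)$. Let $\rho_\gamma$ be the Chernoff index of $g$ and $h_\gamma$. Consider testing $H_0: f=g$ against $H_1: f\in\{h_\gamma:\gamma\in\Gamma\}$ with the rejection region $$C_1=\Big\{(x_1,\dots,x_n):\ \frac{\sup_{\gamma\in\Gamma}\prod_{i=1}^n h_\gamma(x_i)}{\prod_{i=1}^n g(x_i)}>1\Big\}.$$ Then $\min_{\gamma\in\Gamma}\rho_\gamma$ is attained, is positive and finite, and as $n\to\infty$ $$\log P_g(C_1)\ \sim\ \sup_{\gamma\in\Gamma}\log P_{h_\gamma}(C_1^c)\ \sim\ -n\,\min_{\gamma\in\Gamma}\rho_\gamma ,$$ where $a_n\sim b_n$ means $a_n/b_n\to1$. -/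

import Mathlib

open MeasureTheory Filter Asymptotics
open scoped ENNReal Topology

noncomputable section

namespace SeparateFamilies

/-- `f` is a probability density with respect to the baseline measure `μ`. -/
structure IsDensity (μ : Measure ℝ) (f : ℝ → ℝ) : Prop where
  measurable : Measurable f
  nonneg : ∀ x, 0 ≤ f x
  lintegral_eq_one : ∫⁻ x, ENNReal.ofReal (f x) ∂μ = 1

/-- The law on `ℝ` with density `f` with respect to `μ`. -/
def law (μ : Measure ℝ) (f : ℝ → ℝ) : Measure ℝ :=
  μ.withDensity fun x => ENNReal.ofReal (f x)

/-- The law of a sample of `n` independent observations with density `f`. -/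
def sampleLaw (μ : Measure ℝ) (f : ℝ → ℝ) (n : ℕ) : Measure (Fin n → ℝ) :=
  Measure.pi fun _ => law μ f

/-- The log-likelihood ratio `log h(x) - log g(x)` of one observation. -/
def llr (g h : ℝ → ℝ) (x : ℝ) : ℝ := Real.log (h x) - Real.log (g x)

/-- Expectation with values in the extended reals: `E[f⁺] - E[f⁻]`. It is only used for log-likelihood
ratios, for which one of the two terms is always finite. -/
def extExp (ν : Measure ℝ) (f : ℝ → ℝ) : EReal :=
  ((∫⁻ x, ENNReal.ofReal (f x) ∂ν : ℝ≥0∞) : EReal) - ((∫⁻ x, ENNReal.ofReal (-f x) ∂ν : ℝ≥0∞) : EReal)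

/-- Moment generating function, under the density `g`, of the log-likelihood ratio of `h` to `g`:
`M_g(z) = ∫ (h/g)^z g dμ`, possibly infinite. -/
def llrMgf (μ : Measure ℝ) (g h : ℝ → ℝ) (z : ℝ) : ℝ≥0∞ :=
  ∫⁻ x, ENNReal.ofReal (Real.exp (z * llr g h x)) ∂(law μ g)

/-- Rate function `m_g(t) = max_z [z t - log M_g(z)]`. -/
def rate (μ : Measure ℝ) (g h : ℝ → ℝ) (t : ℝ) : EReal :=
  ⨆ z : ℝ, ((z * t : ℝ) : EReal) - ENNReal.log (llrMgf μ g h z)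

/-- The Chernoff index between `g` and `h`: the maximum over `E_g(l) < t < E_h(l)` of
`min {m_g(t), m_h(-t)}`, with `l = log h - log g`; `m_h` is the rate function with the roles of `g` and
`h` exchanged. -/
def chernoffIndex (μ : Measure ℝ) (g h : ℝ → ℝ) : EReal :=
  ⨆ (t : ℝ) (_ : extExp (law μ g) (llr g h) < (t : EReal) ∧
      (t : EReal) < extExp (law μ h) (llr g h)),
    min (rate μ g h t) (rate μ h g (-t))

/-- The set `Γ ⊆ ℝ^d` has continuously differentiable boundary: near each boundary point it is the
sublevel set of a continuously differentiable function with nonvanishing derivative there. -/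
def HasC1Boundary {d : ℕ} (Γ : Set (EuclideanSpace ℝ (Fin d))) : Prop :=
  ∀ p ∈ frontier Γ, ∃ (U : Set (EuclideanSpace ℝ (Fin d))) (φ : EuclideanSpace ℝ (Fin d) → ℝ),
    IsOpen U ∧ p ∈ U ∧ ContDiffOn ℝ 1 φ U ∧ φ p = 0 ∧ fderiv ℝ φ p ≠ 0 ∧
      Γ ∩ U = {x ∈ U | φ x ≤ 0}

/-- Complete separation of `g` from `{h_γ}`: `min_γ E_g(log g - log h_γ) > 0`. -/
def CompleteSeparation {d : ℕ} (μ : Measure ℝ) (g : ℝ → ℝ)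
    (h : EuclideanSpace ℝ (Fin d) → ℝ → ℝ) (Γ : Set (EuclideanSpace ℝ (Fin d))) : Prop :=
  0 < ⨅ γ ∈ Γ, extExp (law μ g) fun x => Real.log (g x) - Real.log (h γ x)

/-- `S(x) = sup_γ |∇_γ l_γ(x)|`, with `l_γ = log h_γ - log g`. The gradient is taken within `Γ`, so that
it is one-sided at boundary points. -/
def gradSup {d : ℕ} (g : ℝ → ℝ) (h : EuclideanSpace ℝ (Fin d) → ℝ → ℝ)
    (Γ : Set (EuclideanSpace ℝ (Fin d))) (x : ℝ) : ℝ≥0∞ :=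
  ⨆ γ ∈ Γ, ‖gradientWithin (fun γ' => llr g (h γ') x) Γ γ‖ₑ

/-- Smoothness in the parameter and the tail condition on `S = sup_γ |∇_γ l_γ|`. Almost surely, all
the `h_γ(X)` are positive and `γ ↦ l_γ(X)` is differentiable on `Γ`; and for some `η > 0` and all large
`x`, the probability of `S > x` under `g` and every `h_γ` is at most `exp (-(log x)^(1+η))`.
(Taking the threshold `x₀` at least `1` loses nothing and keeps `log x` nonnegative.) -/
def GradientTail {d : ℕ} (μ : Measure ℝ) (g : ℝ → ℝ)
    (h : EuclideanSpace ℝ (Fin d) → ℝ → ℝ) (Γ : Set (EuclideanSpace ℝ (Fin d))) : Prop :=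
  (∀ᵐ x ∂(law μ g), (∀ γ ∈ Γ, 0 < h γ x) ∧ DifferentiableOn ℝ (fun γ => llr g (h γ) x) Γ) ∧
  ∃ η > (0 : ℝ), ∃ x₀ ≥ (1 : ℝ), ∀ x > x₀, ∀ γ ∈ Γ,
    law μ g {y | ENNReal.ofReal x < gradSup g h Γ y} ≤
        ENNReal.ofReal (Real.exp (-(Real.log x) ^ (1 + η))) ∧
      law μ (h γ) {y | ENNReal.ofReal x < gradSup g h Γ y} ≤
        ENNReal.ofReal (Real.exp (-(Real.log x) ^ (1 + η)))

/-- Generalized likelihood ratio statistic `max_γ ∏ h_γ(x_i) / ∏ g(x_i)`. -/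
def glr {d : ℕ} (g : ℝ → ℝ) (h : EuclideanSpace ℝ (Fin d) → ℝ → ℝ)
    (Γ : Set (EuclideanSpace ℝ (Fin d))) (n : ℕ) (x : Fin n → ℝ) : ℝ :=
  (⨆ γ : Γ, ∏ i, h γ (x i)) / ∏ i, g (x i)

/-- Rejection region `C_λ = {LR_n > λ}`. -/
def rejectionRegion {d : ℕ} (g : ℝ → ℝ) (h : EuclideanSpace ℝ (Fin d) → ℝ → ℝ)
    (Γ : Set (EuclideanSpace ℝ (Fin d))) (lam : ℝ) (n : ℕ) : Set (Fin n → ℝ) :=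
  {x | lam < glr g h Γ n x}

end SeparateFamilies

end

namespace SeparateFamilies

section Geometry

variable {E : Type*} [NormedAddCommGroup E] [NormedSpace ℝ E]

theorem abs_sub_le_of_segment_subset {s : Set E} {f : E → ℝ} {K : ℝ} {a b : E}
    (hf : DifferentiableOn ℝ f s) (hK : ∀ x ∈ s, ‖fderivWithin ℝ f s x‖ ≤ K)
    (hab : segment ℝ a b ⊆ s) : |f b - f a| ≤ K * ‖b - a‖ := by
  have := Convex.norm_image_sub_le_of_norm_hasFDerivWithin_le (𝕜 := ℝ) (f := f)
    (f' := fderivWithin ℝ f s) (s := segment ℝ a b) (C := K)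
    (fun x hx => ((hf x (hab hx)).hasFDerivWithinAt).mono hab) (fun x hx => hK x (hab hx))
    (convex_segment a b) (left_mem_segment ℝ a b) (right_mem_segment ℝ a b)
  simpa [Real.norm_eq_abs] using this

/-- Near a regular boundary point, two points of a sublevel set are joined inside it by a polygonal
path whose three segments have total length comparable to the distance of the points. -/
theorem exists_polygonal_path {s U : Set E} {φ : E → ℝ} {p : E}
    (hU : IsOpen U) (hpU : p ∈ U) (hφ : ContDiffOn ℝ 1 φ U)
    (hD : fderiv ℝ φ p ≠ 0) (hs : s ∩ U = {x ∈ U | φ x ≤ 0}) :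
    ∃ r > 0, ∃ C ≥ (0 : ℝ), ∀ a ∈ s ∩ Metric.ball p r, ∀ b ∈ s ∩ Metric.ball p r, ∃ w : E,
      ‖w‖ ≤ C * ‖b - a‖ ∧ segment ℝ a (a + w) ⊆ s ∧ segment ℝ (a + w) (b + w) ⊆ s ∧
        segment ℝ b (b + w) ⊆ s := by
  have hstrict : HasStrictFDerivAt φ (fderiv ℝ φ p) p :=
    (hφ.contDiffAt (hU.mem_nhds hpU)).hasStrictFDerivAt (by norm_num)
  set D := fderiv ℝ φ p with hDdef
  obtain ⟨v, hv⟩ : ∃ v, D v = -1 := by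
    obtain ⟨w, hw⟩ : ∃ w, D w ≠ 0 := by
      by_contra! hcon
      exact hD (ContinuousLinearMap.ext fun w => by simpa using hcon w)
    exact ⟨(-(D w)⁻¹) • w, by simp [hw]⟩
  set c : NNReal := ⟨1 / (2 * (‖v‖ + 1)), by positivity⟩ with hc
  have hcpos : (0 : ℝ) < c := by change (0 : ℝ) < 1 / (2 * (‖v‖ + 1)); positivity
  have hcv : (c : ℝ) * ‖v‖ ≤ 1 / 2 := by
    change 1 / (2 * (‖v‖ + 1)) * ‖v‖ ≤ 1 / 2
    rw [div_mul_eq_mul_div, div_le_div_iff₀ (by positivity) (by positivity)]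
    nlinarith [norm_nonneg v]
  obtain ⟨T, hT, hlin⟩ := hstrict.approximates_deriv_on_nhds (c := c) (Or.inr hcpos)
  obtain ⟨R, hR, hRsub⟩ := Metric.mem_nhds_iff.1 (inter_mem hT (hU.mem_nhds hpU))
  have hdesc : ∀ x ∈ Metric.ball p R, ∀ t : ℝ, 0 ≤ t → x + t • v ∈ Metric.ball p R →
      φ (x + t • v) ≤ φ x - t / 2 := by
    intro x hx t ht hxt
    have h1 := hlin (x + t • v) (hRsub hxt).1 x (hRsub hx).1
    rw [add_sub_cancel_left, map_smul, hv, norm_smul, Real.norm_eq_abs, Real.norm_eq_abs,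
      abs_of_nonneg ht, smul_eq_mul] at h1
    have h2 := (abs_le.1 h1).2
    nlinarith
  set L : ℝ := ‖D‖ + c with hL
  have hL0 : 0 ≤ L := by positivity
  have hlip : ∀ x ∈ Metric.ball p R, ∀ y ∈ Metric.ball p R, φ y ≤ φ x + L * ‖y - x‖ := by
    intro x hx y hy
    have h1 := hlin y (hRsub hy).1 x (hRsub hx).1
    rw [Real.norm_eq_abs] at h1
    have h2 := (abs_le.1 h1).2
    have h3 := (le_abs_self _).trans (D.le_opNorm (y - x))
    rw [hL, add_mul]
    linarith
  have hmem : ∀ x ∈ Metric.ball p R, φ x ≤ 0 → x ∈ s := fun x hx hx0 =>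
    (hs.symm.subset ⟨(hRsub hx).2, hx0⟩).1
  have hneg : ∀ x ∈ s ∩ Metric.ball p R, φ x ≤ 0 := fun x hx =>
    (hs.subset ⟨hx.1, (hRsub hx.2).2⟩).2
  have hden : 0 < 1 + 4 * L * ‖v‖ := by positivity
  refine ⟨R / (1 + 4 * L * ‖v‖), by positivity, 2 * L * ‖v‖, by positivity, ?_⟩
  set r := R / (1 + 4 * L * ‖v‖) with hr
  have hrR : r * (1 + 4 * L * ‖v‖) = R := by rw [hr]; field_simp
  have hr0 : 0 < r := by positivity
  have hrle : r ≤ R := by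
    rw [← hrR]; nlinarith [mul_nonneg (mul_nonneg (by norm_num : (0 : ℝ) ≤ 4) hL0) (norm_nonneg v)]
  rintro a ⟨has, har⟩ b ⟨hbs, hbr⟩
  have hab : ‖b - a‖ ≤ 2 * r := by
    have := dist_triangle_right b a p
    rw [← dist_eq_norm]
    rw [Metric.mem_ball] at har hbr
    linarith
  set t₀ := 2 * L * ‖b - a‖ with ht₀
  have ht₀0 : 0 ≤ t₀ := by positivity
  have hshift : ∀ x ∈ Metric.ball p r, ∀ t : ℝ, 0 ≤ t → t ≤ t₀ → x + t • v ∈ Metric.ball p R := by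
    intro x hx t ht htt
    rw [mem_ball_iff_norm] at hx ⊢
    calc ‖x + t • v - p‖ = ‖(x - p) + t • v‖ := by congr 1; abel
      _ ≤ ‖x - p‖ + t * ‖v‖ := by
        refine (norm_add_le _ _).trans ?_
        rw [norm_smul, Real.norm_eq_abs, abs_of_nonneg ht]
      _ < r + t₀ * ‖v‖ := add_lt_add_of_lt_of_le hx (by gcongr)
      _ ≤ r + 2 * L * (2 * r) * ‖v‖ := by rw [ht₀]; gcongr
      _ = R := by rw [← hrR]; ring
  have hball := Metric.ball_subset_ball (x := p) hrle
  have hvert : ∀ x ∈ s ∩ Metric.ball p r, segment ℝ x (x + t₀ • v) ⊆ s := by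
    rintro x ⟨hxs, hxr⟩ y hy
    rw [segment_eq_image'] at hy
    obtain ⟨θ, ⟨hθ0, hθ1⟩, rfl⟩ := hy
    simp only [add_sub_cancel_left, smul_smul]
    have hm := hshift x hxr (θ * t₀) (by positivity) (by nlinarith)
    refine hmem _ hm ?_
    have := hdesc x (hball hxr) (θ * t₀) (by positivity) hm
    have h0 := hneg x ⟨hxs, hball hxr⟩
    have : 0 ≤ θ * t₀ := by positivity
    linarith
  refine ⟨t₀ • v, ?_, hvert a ⟨has, har⟩, ?_, hvert b ⟨hbs, hbr⟩⟩
  · rw [norm_smul, Real.norm_eq_abs, abs_of_nonneg ht₀0, ht₀]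
    exact le_of_eq (by ring)
  · intro y hy
    rw [segment_eq_image'] at hy
    obtain ⟨θ, ⟨hθ0, hθ1⟩, rfl⟩ := hy
    have e1 : a + t₀ • v + θ • (b + t₀ • v - (a + t₀ • v)) = (a + θ • (b - a)) + t₀ • v := by
      rw [add_sub_add_right_eq_sub]; abel
    have hc : a + θ • (b - a) ∈ Metric.ball p r :=
      (convex_ball p r).segment_subset har hbr
        (by rw [segment_eq_image']; exact ⟨θ, ⟨hθ0, hθ1⟩, rfl⟩)
    have hm := hshift _ hc t₀ ht₀0 le_rfl
    simp only [e1]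
    refine hmem _ hm ?_
    have hma := hshift a har t₀ ht₀0 le_rfl
    have h1 := hlip _ hma _ hm
    have h2 := hdesc a (hball har) t₀ ht₀0 hma
    have h0 := hneg a ⟨has, hball har⟩
    have e2 : a + θ • (b - a) + t₀ • v - (a + t₀ • v) = θ • (b - a) := by abel
    rw [e2, norm_smul, Real.norm_eq_abs, abs_of_nonneg hθ0] at h1
    have h3 : L * (θ * ‖b - a‖) ≤ L * ‖b - a‖ := by
      gcongr
      exact mul_le_of_le_one_left (norm_nonneg _) hθ1
    rw [ht₀] at h2
    linarith

end Geometry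

section Parameter

variable {d : ℕ} {Γ : Set (EuclideanSpace ℝ (Fin d))}

/-- On a compact set with continuously differentiable boundary, nearby increments of a differentiable
function are controlled by the supremum of its derivative. -/
theorem exists_local_lipschitz (hΓc : IsCompact Γ) (hΓb : HasC1Boundary Γ) :
    ∃ C ≥ (0 : ℝ), ∃ r > (0 : ℝ), ∀ a ∈ Γ, ∀ b ∈ Γ, dist a b < r →
      ∀ (f : EuclideanSpace ℝ (Fin d) → ℝ) (K : ℝ), 0 ≤ K → DifferentiableOn ℝ f Γ →
        (∀ x ∈ Γ, ‖fderivWithin ℝ f Γ x‖ ≤ K) → |f b - f a| ≤ C * K * ‖b - a‖ := by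
  suffices H : ∃ C ≥ (0 : ℝ), ∃ r > (0 : ℝ), ∀ a ∈ Γ, a ∈ Γ → ∀ b ∈ Γ, dist a b < r →
      ∀ (f : EuclideanSpace ℝ (Fin d) → ℝ) (K : ℝ), 0 ≤ K → DifferentiableOn ℝ f Γ →
        (∀ x ∈ Γ, ‖fderivWithin ℝ f Γ x‖ ≤ K) → |f b - f a| ≤ C * K * ‖b - a‖ by
    obtain ⟨C, hC, r, hr, H⟩ := H
    exact ⟨C, hC, r, hr, fun a ha => H a ha ha⟩
  refine hΓc.induction_on (p := fun s => ∃ C ≥ (0 : ℝ), ∃ r > (0 : ℝ), ∀ a ∈ s, a ∈ Γ → ∀ b ∈ Γ,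
      dist a b < r → ∀ (f : EuclideanSpace ℝ (Fin d) → ℝ) (K : ℝ), 0 ≤ K →
        DifferentiableOn ℝ f Γ → (∀ x ∈ Γ, ‖fderivWithin ℝ f Γ x‖ ≤ K) →
          |f b - f a| ≤ C * K * ‖b - a‖) ?_ ?_ ?_ ?_
  · exact ⟨0, le_rfl, 1, one_pos, by simp⟩
  · rintro s t hst ⟨C, hC, r, hr, H⟩
    exact ⟨C, hC, r, hr, fun a ha => H a (hst ha)⟩
  · rintro s t ⟨C, hC, r, hr, H⟩ ⟨C', hC', r', hr', H'⟩
    refine ⟨max C C', le_max_of_le_left hC, min r r', lt_min hr hr', ?_⟩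
    rintro a (ha | ha) haΓ b hb hab f K hK hf hfK
    · refine (H a ha haΓ b hb (hab.trans_le (min_le_left _ _)) f K hK hf hfK).trans ?_
      gcongr; exact le_max_left _ _
    · refine (H' a ha haΓ b hb (hab.trans_le (min_le_right _ _)) f K hK hf hfK).trans ?_
      gcongr; exact le_max_right _ _
  · intro p hp
    suffices H : ∃ C ≥ (0 : ℝ), ∃ r > (0 : ℝ), ∀ a ∈ Γ ∩ Metric.ball p r,
        ∀ b ∈ Γ ∩ Metric.ball p r, ∀ (f : EuclideanSpace ℝ (Fin d) → ℝ) (K : ℝ), 0 ≤ K →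
          DifferentiableOn ℝ f Γ → (∀ x ∈ Γ, ‖fderivWithin ℝ f Γ x‖ ≤ K) →
            |f b - f a| ≤ C * K * ‖b - a‖ by
      obtain ⟨C, hC, r, hr, H⟩ := H
      refine ⟨Metric.ball p (r / 2), mem_nhdsWithin_of_mem_nhds (Metric.ball_mem_nhds p (by positivity)),
        C, hC, r / 2, by positivity, ?_⟩
      intro a ha haΓ b hb hab
      rw [Metric.mem_ball] at ha
      refine H a ⟨haΓ, ?_⟩ b ⟨hb, ?_⟩
      · rw [Metric.mem_ball]; linarith
      · rw [Metric.mem_ball]; linarith [dist_triangle_left b p a]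
    by_cases hpi : p ∈ interior Γ
    · obtain ⟨r, hr, hsub⟩ := Metric.mem_nhds_iff.1 (mem_interior_iff_mem_nhds.1 hpi)
      refine ⟨1, zero_le_one, r, hr, ?_⟩
      rintro a ⟨-, ha⟩ b ⟨-, hb⟩ f K hK hf hfK
      rw [one_mul]
      exact abs_sub_le_of_segment_subset hf hfK (((convex_ball p r).segment_subset ha hb).trans hsub)
    · obtain ⟨U, φ, hU, hpU, hφ, -, hD, hs⟩ := hΓb p ⟨subset_closure hp, hpi⟩
      obtain ⟨r, hr, C, hC, H⟩ := exists_polygonal_path hU hpU hφ hD hs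
      refine ⟨2 * C + 1, by positivity, r, hr, ?_⟩
      intro a ha b hb f K hK hf hfK
      obtain ⟨w, hw, h1, h2, h3⟩ := H a ha b hb
      have b1 := abs_sub_le_of_segment_subset hf hfK h1
      have b2 := abs_sub_le_of_segment_subset hf hfK h2
      have b3 := abs_sub_le_of_segment_subset hf hfK h3
      rw [add_sub_cancel_left] at b1 b3
      rw [add_sub_add_right_eq_sub] at b2
      have e : f b - f a = -(f (b + w) - f b) + (f (b + w) - f (a + w)) + (f (a + w) - f a) := by ring
      have hKw : K * ‖w‖ ≤ K * (C * ‖b - a‖) := by gcongr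
      rw [e]
      refine (abs_add_three _ _ _).trans ?_
      rw [abs_neg]
      linarith

/-- A bounded subset of `ℝ^d` is covered by at most `A δ^{-d}` balls of radius `δ ≤ 1` centred in it. -/
theorem exists_cover_card_le (hΓ : Bornology.IsBounded Γ) :
    ∃ A > (0 : ℝ), ∀ δ : ℝ, 0 < δ → δ ≤ 1 → ∃ t : Finset (EuclideanSpace ℝ (Fin d)),
      (∀ x ∈ t, x ∈ Γ) ∧ (∀ y ∈ Γ, ∃ x ∈ t, dist x y < δ) ∧ (t.card : ℝ) ≤ A * δ⁻¹ ^ d := by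
  obtain ⟨R, hR, hsub⟩ := hΓ.subset_closedBall_lt 0 0
  refine ⟨(2 * R * (d + 1) + 5) ^ d, by positivity, ?_⟩
  intro δ hδ hδ1
  set m : ℝ := (d + 1) / δ with hm
  have hm0 : 0 < m := by positivity
  set F : EuclideanSpace ℝ (Fin d) → (Fin d → ℤ) := fun x i => ⌊x i * m⌋ with hF
  set N : ℤ := ⌈R * m⌉ + 1 with hN
  have hRm : 0 ≤ R * m := by positivity
  have hN0 : 0 ≤ N := by have := Int.ceil_nonneg hRm; omega
  set B : Finset (Fin d → ℤ) := Fintype.piFinset fun _ => Finset.Icc (-N) N with hB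
  have hFB : F '' Γ ⊆ B := by
    rintro _ ⟨x, hx, rfl⟩
    have hxR : ‖x‖ ≤ R := by simpa using hsub hx
    rw [hB, Finset.mem_coe, Fintype.mem_piFinset]
    intro i
    have hi := abs_le.1 ((PiLp.norm_apply_le x i).trans hxR)
    have h1 : x i * m ≤ R * m := by have := hi.2; gcongr
    have h2 : -(R * m) ≤ x i * m := by rw [← neg_mul]; have := hi.1; gcongr
    have h3 := Int.le_ceil (R * m)
    rw [Finset.mem_Icc]
    constructor
    · rw [hF, Int.le_floor, hN]; push_cast; linarith
    · have : ((⌊x i * m⌋ : ℤ) : ℝ) ≤ ((N : ℤ) : ℝ) := by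
        rw [hN]; push_cast; linarith [Int.floor_le (x i * m)]
      exact_mod_cast this
  obtain ⟨t', ht'Γ, hbij⟩ := Set.exists_subset_bijOn Γ F
  have hfin : t'.Finite :=
    Set.Finite.of_finite_image (B.finite_toSet.subset (hbij.image_eq ▸ hFB)) hbij.injOn
  refine ⟨hfin.toFinset, fun x hx => ht'Γ (by simpa using hx), ?_, ?_⟩
  · intro y hy
    obtain ⟨x, hx, hxy⟩ := hbij.surjOn ⟨y, hy, rfl⟩
    refine ⟨x, by simpa using hx, ?_⟩
    have hcoord : ∀ i, (x i - y i) ^ 2 ≤ (1 / m) ^ 2 := by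
      intro i
      have h1 : ⌊x i * m⌋ = ⌊y i * m⌋ := congrFun hxy i
      have h2 := (Int.abs_sub_lt_one_of_floor_eq_floor h1).le
      rw [← sub_mul, abs_mul, abs_of_pos hm0, ← le_div_iff₀ hm0] at h2
      exact sq_le_sq.2 (h2.trans (le_abs_self _))
    rw [EuclideanSpace.dist_eq, Real.sqrt_lt' hδ]
    calc ∑ i, dist (x i) (y i) ^ 2 = ∑ i, (x i - y i) ^ 2 := by simp [Real.dist_eq, sq_abs]
      _ ≤ ∑ _i : Fin d, (1 / m) ^ 2 := Finset.sum_le_sum fun i _ => hcoord i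
      _ = d * (δ / (d + 1)) ^ 2 := by rw [hm]; simp
      _ < δ ^ 2 := by
        rw [div_pow, ← mul_div_assoc, div_lt_iff₀ (by positivity), mul_comm]
        have : (d : ℝ) < (d + 1) ^ 2 := by nlinarith [(Nat.cast_nonneg d : (0 : ℝ) ≤ d)]
        have := sq_pos_of_pos hδ
        gcongr
  · have hcard : hfin.toFinset.card ≤ B.card := by
      refine Finset.card_le_card_of_injOn F ?_ (by simpa using hbij.injOn)
      intro x hx
      exact hFB ⟨x, ht'Γ (by simpa using hx), rfl⟩
    have hBc : (B.card : ℝ) = (2 * N + 1 : ℝ) ^ d := by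
      rw [hB, Fintype.card_piFinset_const, Int.card_Icc]
      push_cast
      congr 1
      have : ((N + 1 - -N).toNat : ℤ) = 2 * N + 1 := by rw [Int.toNat_of_nonneg (by omega)]; ring
      exact_mod_cast congrArg (fun z : ℤ => (z : ℝ)) this
    calc (hfin.toFinset.card : ℝ) ≤ B.card := by exact_mod_cast hcard
      _ = (2 * N + 1 : ℝ) ^ d := hBc
      _ ≤ ((2 * R * (d + 1) + 5) * δ⁻¹) ^ d := by
        have h0 : (0 : ℝ) ≤ N := by exact_mod_cast hN0
        gcongr
        have h1 : (N : ℝ) ≤ R * m + 2 := by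
          rw [hN]; push_cast; linarith [Int.ceil_lt_add_one (R * m)]
        have h2 : 1 ≤ δ⁻¹ := (one_le_inv₀ hδ).2 hδ1
        have h3 : R * m = R * (d + 1) * δ⁻¹ := by rw [hm]; ring
        rw [h3] at h1
        nlinarith
      _ = _ := by rw [mul_pow]

end Parameter

end SeparateFamilies

namespace SeparateFamilies

/-- The exponential moment `∫ exp (z l) dp`. -/
noncomputable def expMoment (p : Measure ℝ) (l : ℝ → ℝ) (z : ℝ) : ℝ≥0∞ :=
  ∫⁻ x, ENNReal.ofReal (Real.exp (z * l x)) ∂p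

/-- `l` is the logarithm of the density of `q` with respect to `p`. -/
structure IsLogRatio (p q : Measure ℝ) (l : ℝ → ℝ) : Prop where
  measurable : Measurable l
  eq_withDensity : q = p.withDensity fun x => ENNReal.ofReal (Real.exp (l x))

theorem extExp_eq_integral {p : Measure ℝ} {f : ℝ → ℝ} (hf : Integrable f p) :
    extExp p f = ((∫ x, f x ∂p : ℝ) : EReal) := by
  have h1 : ∫⁻ x, ENNReal.ofReal (f x) ∂p ≠ ⊤ := hf.lintegral_lt_top.ne
  have h2 : ∫⁻ x, ENNReal.ofReal (-f x) ∂p ≠ ⊤ := hf.neg.lintegral_lt_top.ne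
  rw [extExp, integral_eq_lintegral_pos_part_sub_lintegral_neg_part hf, EReal.coe_sub,
    EReal.coe_ennreal_toReal h1, EReal.coe_ennreal_toReal h2]

theorem integrable_of_lintegral_ne_top {p : Measure ℝ} {f : ℝ → ℝ} (hf : Measurable f)
    (h1 : ∫⁻ x, ENNReal.ofReal (f x) ∂p ≠ ⊤) (h2 : ∫⁻ x, ENNReal.ofReal (-f x) ∂p ≠ ⊤) :
    Integrable f p := by
  have h1' : Integrable (fun x => max (f x) 0) p := by
    rw [← lintegral_ofReal_ne_top_iff_integrable (f := fun x => max (f x) 0) (by fun_prop)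
      (ae_of_all _ fun x => le_max_right (f x) 0)]
    simpa using h1
  have h2' : Integrable (fun x => max (-f x) 0) p := by
    rw [← lintegral_ofReal_ne_top_iff_integrable (f := fun x => max (-f x) 0) (by fun_prop)
      (ae_of_all _ fun x => le_max_right (-f x) 0)]
    simpa using h2
  refine (h1'.sub h2').congr (ae_of_all _ fun x => ?_)
  simp only [Pi.sub_apply]
  rcases le_total (f x) 0 with h | h
  · rw [max_eq_right h, max_eq_left (by linarith)]; ring
  · rw [max_eq_left h, max_eq_right (by linarith)]; ring

theorem extExp_neg {p : Measure ℝ} {f : ℝ → ℝ}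
    (h : ∫⁻ x, ENNReal.ofReal (f x) ∂p ≠ ⊤ ∨ ∫⁻ x, ENNReal.ofReal (-f x) ∂p ≠ ⊤) :
    extExp p (fun x => -f x) = -extExp p f := by
  rw [extExp, extExp, EReal.neg_sub]
  · simp only [neg_neg]
    rw [sub_eq_add_neg, add_comm]
  · exact Or.inl (EReal.coe_ennreal_ne_bot _)
  · simpa using h

theorem log_ofReal_exp (x : ℝ) : ENNReal.log (ENNReal.ofReal (Real.exp x)) = x := by
  rw [ENNReal.log_ofReal_of_pos (Real.exp_pos x), Real.log_exp]

theorem expMoment_zero (p : Measure ℝ) [IsProbabilityMeasure p] (l : ℝ → ℝ) :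
    expMoment p l 0 = 1 := by
  simp [expMoment]

namespace IsLogRatio

variable {p q : Measure ℝ} {l : ℝ → ℝ}

theorem symm (H : IsLogRatio p q l) : IsLogRatio q p (fun x => -l x) := by
  have hm := H.measurable
  refine ⟨hm.neg, ?_⟩
  rw [H.eq_withDensity, ← withDensity_mul₀ (by fun_prop) (by fun_prop)]
  have : ((fun x => ENNReal.ofReal (Real.exp (l x))) * fun x => ENNReal.ofReal (Real.exp (-l x)))
      = 1 := by
    funext x
    rw [Pi.mul_apply, ← ENNReal.ofReal_mul (Real.exp_nonneg _), ← Real.exp_add]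
    simp
  rw [this, withDensity_one]

theorem absolutelyContinuous (H : IsLogRatio p q l) : q ≪ p := by
  rw [H.eq_withDensity]; exact withDensity_absolutelyContinuous _ _

theorem expMoment_symm (H : IsLogRatio p q l) (z : ℝ) :
    expMoment q (fun x => -l x) z = expMoment p l (1 - z) := by
  have hm := H.measurable
  rw [expMoment, expMoment, H.eq_withDensity,
    lintegral_withDensity_eq_lintegral_mul _ (by fun_prop) (by fun_prop)]
  refine lintegral_congr fun x => ?_
  rw [Pi.mul_apply, ← ENNReal.ofReal_mul (Real.exp_nonneg _), ← Real.exp_add]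
  congr 2; ring

theorem lintegral_exp [IsProbabilityMeasure q] (H : IsLogRatio p q l) :
    ∫⁻ x, ENNReal.ofReal (Real.exp (l x)) ∂p = 1 := by
  rw [← measure_univ (μ := q), H.eq_withDensity, withDensity_apply _ MeasurableSet.univ,
    Measure.restrict_univ]

theorem integrable_exp [IsProbabilityMeasure q] (H : IsLogRatio p q l) :
    Integrable (fun x => Real.exp (l x)) p := by
  have hm := H.measurable
  rw [← lintegral_ofReal_ne_top_iff_integrable (by fun_prop)
    (ae_of_all _ fun x => (Real.exp_pos _).le), H.lintegral_exp]
  exact ENNReal.one_ne_top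

theorem integral_exp [IsProbabilityMeasure q] (H : IsLogRatio p q l) :
    ∫ x, Real.exp (l x) ∂p = 1 := by
  have := ofReal_integral_eq_lintegral_ofReal H.integrable_exp
    (ae_of_all _ fun x => (Real.exp_pos _).le)
  rw [H.lintegral_exp] at this
  exact ENNReal.ofReal_eq_one.1 this

theorem lintegral_ofReal_ne_top [IsProbabilityMeasure q] (H : IsLogRatio p q l) :
    ∫⁻ x, ENNReal.ofReal (l x) ∂p ≠ ⊤ := by
  refine ne_top_of_le_ne_top (b := 1) ENNReal.one_ne_top ?_
  rw [← H.lintegral_exp]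
  exact lintegral_mono fun x => ENNReal.ofReal_le_ofReal (by linarith [Real.add_one_le_exp (l x)])

theorem exists_pos_le_expMoment [IsProbabilityMeasure p] (H : IsLogRatio p q l) :
    ∃ c : ℝ, ∀ z ∈ Set.Ioo (0 : ℝ) 1, ENNReal.ofReal (Real.exp (-c)) ≤ expMoment p l z := by
  have hm := H.measurable
  set I := ∫⁻ x, ENNReal.ofReal (Real.exp (-|l x|)) ∂p with hI
  have hI0 : I ≠ 0 := by
    rw [hI, Ne, lintegral_eq_zero_iff (by fun_prop)]
    intro h
    obtain ⟨x, hx⟩ := h.exists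
    simp [(Real.exp_pos _).not_ge] at hx
  have hI1 : I ≠ ⊤ := by
    refine ne_top_of_le_ne_top (b := 1) ENNReal.one_ne_top ?_
    calc I ≤ ∫⁻ _, 1 ∂p := lintegral_mono fun x => by
          rw [← ENNReal.ofReal_one]
          exact ENNReal.ofReal_le_ofReal (Real.exp_le_one_iff.2 (by simp))
      _ = 1 := by simp
  refine ⟨-Real.log I.toReal, fun z hz => ?_⟩
  rw [neg_neg, Real.exp_log (ENNReal.toReal_pos hI0 hI1), ENNReal.ofReal_toReal hI1]
  refine lintegral_mono fun x => ENNReal.ofReal_le_ofReal (Real.exp_le_exp.2 ?_)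
  have h1 : |z * l x| ≤ |l x| := by
    rw [abs_mul, abs_of_pos hz.1]
    exact mul_le_of_le_one_left (abs_nonneg _) hz.2.le
  linarith [neg_abs_le (z * l x)]

variable [IsProbabilityMeasure p] [IsProbabilityMeasure q]

/-- Jensen's inequality for negative exponents. -/
theorem ofReal_exp_le_expMoment (H : IsLogRatio p q l) {t z : ℝ} (ht : extExp p l < t)
    (hz : z ≤ 0) : ENNReal.ofReal (Real.exp (z * t)) ≤ expMoment p l z := by
  have hm := H.measurable
  rcases hz.eq_or_lt with rfl | hz
  · simp [expMoment_zero]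
  by_cases hM : expMoment p l z = ⊤
  · simp [hM]
  have hneg : ∫⁻ x, ENNReal.ofReal (-l x) ∂p ≠ ⊤ := by
    refine ne_top_of_le_ne_top (b := ENNReal.ofReal (1 / -z) * expMoment p l z)
      (ENNReal.mul_ne_top ENNReal.ofReal_ne_top hM) ?_
    rw [expMoment, ← lintegral_const_mul _ (by fun_prop)]
    refine lintegral_mono fun x => ?_
    rw [← ENNReal.ofReal_mul (one_div_nonneg.2 (by linarith))]
    refine ENNReal.ofReal_le_ofReal ?_
    rw [one_div, inv_mul_eq_div, le_div_iff₀ (by linarith)]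
    linarith [Real.add_one_le_exp (z * l x)]
  have hl : Integrable l p := integrable_of_lintegral_ne_top hm H.lintegral_ofReal_ne_top hneg
  rw [extExp_eq_integral hl, EReal.coe_lt_coe_iff] at ht
  have hexp : Integrable (fun x => Real.exp (z * l x)) p := by
    rw [← lintegral_ofReal_ne_top_iff_integrable (by fun_prop)
      (ae_of_all _ fun x => (Real.exp_pos _).le)]
    exact hM
  rw [expMoment, ← ofReal_integral_eq_lintegral_ofReal hexp
    (ae_of_all _ fun x => (Real.exp_pos _).le)]
  refine ENNReal.ofReal_le_ofReal ?_
  have hlin : Integrable (fun x => z * (l x - t)) p := (hl.sub (integrable_const _)).const_mul z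
  have h1 : ∫ x, (Real.exp (z * t) * (1 + z * (l x - t))) ∂p ≤ ∫ x, Real.exp (z * l x) ∂p := by
    refine integral_mono ?_ hexp fun x => ?_
    · exact ((integrable_const _).add hlin).const_mul _
    · have e : Real.exp (z * l x) = Real.exp (z * t) * Real.exp (z * (l x - t)) := by
        rw [← Real.exp_add]; congr 1; ring
      simp only [e]
      gcongr
      linarith [Real.add_one_le_exp (z * (l x - t))]
  refine le_trans ?_ h1
  rw [integral_const_mul, integral_add (integrable_const _) hlin, integral_const_mul,
    integral_sub hl (integrable_const _)]
  simp only [integral_const, probReal_univ, one_smul]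
  refine le_mul_of_one_le_right (Real.exp_nonneg _) ?_
  nlinarith

theorem extExp_neg_of_not_ae_zero (H : IsLogRatio p q l) (hne : ¬ l =ᵐ[p] 0) :
    extExp p l < 0 := by
  have hm := H.measurable
  by_cases hneg : ∫⁻ x, ENNReal.ofReal (-l x) ∂p = ⊤
  · rw [extExp, hneg, EReal.coe_ennreal_top, EReal.sub_top]
    · exact EReal.bot_lt_zero
  have hl : Integrable l p := integrable_of_lintegral_ne_top hm H.lintegral_ofReal_ne_top hneg
  rw [extExp_eq_integral hl, ← EReal.coe_zero, EReal.coe_lt_coe_iff]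
  by_contra! hcon
  have hnn : 0 ≤ᵐ[p] fun x => Real.exp (l x) - 1 - l x :=
    ae_of_all _ fun x => by simp only [Pi.zero_apply]; linarith [Real.add_one_le_exp (l x)]
  have hint' : Integrable (fun x => Real.exp (l x) - 1) p := H.integrable_exp.sub (integrable_const _)
  have hint : Integrable (fun x => Real.exp (l x) - 1 - l x) p := hint'.sub hl
  have h0 : ∫ x, (Real.exp (l x) - 1 - l x) ∂p = 0 := by
    refine le_antisymm ?_ (integral_nonneg_of_ae hnn)
    rw [integral_sub hint' hl,
      integral_sub H.integrable_exp (integrable_const _), H.integral_exp]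
    simp [hcon]
  refine hne ?_
  filter_upwards [(integral_eq_zero_iff_of_nonneg_ae hnn hint).1 h0] with x hx
  by_contra hx0
  have := Real.add_one_lt_exp hx0
  simp only [Pi.zero_apply] at hx
  linarith

theorem zero_lt_extExp_of_not_ae_zero (H : IsLogRatio p q l) (hne : ¬ l =ᵐ[p] 0) :
    0 < extExp q l := by
  have h1 : ¬ (fun x => -l x) =ᵐ[q] 0 := by
    intro h
    refine hne ?_
    filter_upwards [H.symm.absolutelyContinuous.ae_le h] with x hx
    simpa using hx
  have h2 := H.symm.extExp_neg_of_not_ae_zero h1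
  rw [extExp_neg (Or.inr H.symm.lintegral_ofReal_ne_top)] at h2
  exact EReal.neg_lt_neg_iff.1 (by simpa using h2)

theorem expMoment_half_lt_one (H : IsLogRatio p q l) (hne : ¬ l =ᵐ[p] 0) :
    expMoment p l (1 / 2) < 1 := by
  have hm := H.measurable
  have hle : ∀ x, Real.exp (1 / 2 * l x) ≤ (1 + Real.exp (l x)) / 2 := fun x => by
    have : Real.exp (l x) = Real.exp (1 / 2 * l x) ^ 2 := by
      rw [← Real.exp_nat_mul]; congr 1; push_cast; ring
    rw [this]; nlinarith [sq_nonneg (1 - Real.exp (1 / 2 * l x))]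
  have hint1 : Integrable (fun x => (1 + Real.exp (l x)) / 2) p :=
    ((integrable_const _).add H.integrable_exp).div_const _
  have hint : Integrable (fun x => Real.exp (1 / 2 * l x)) p := by
    refine hint1.mono' (by fun_prop) (ae_of_all _ fun x => ?_)
    rw [Real.norm_eq_abs, abs_of_pos (Real.exp_pos _)]
    exact hle x
  rw [expMoment, ← ofReal_integral_eq_lintegral_ofReal hint
    (ae_of_all _ fun x => (Real.exp_pos _).le), ← ENNReal.ofReal_one,
    ENNReal.ofReal_lt_ofReal_iff one_pos]
  by_contra! hcon
  have hnn : 0 ≤ᵐ[p] fun x => (1 + Real.exp (l x)) / 2 - Real.exp (1 / 2 * l x) :=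
    ae_of_all _ fun x => sub_nonneg.2 (hle x)
  have h0 : ∫ x, ((1 + Real.exp (l x)) / 2 - Real.exp (1 / 2 * l x)) ∂p = 0 := by
    refine le_antisymm ?_ (integral_nonneg_of_ae hnn)
    rw [integral_sub hint1 hint, integral_div, integral_add (integrable_const _) H.integrable_exp,
      H.integral_exp]
    simp only [integral_const, probReal_univ, one_smul]
    linarith
  refine hne ?_
  filter_upwards [(integral_eq_zero_iff_of_nonneg_ae hnn (hint1.sub hint)).1 h0] with x hx
  have : Real.exp (l x) = Real.exp (1 / 2 * l x) ^ 2 := by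
    rw [← Real.exp_nat_mul]; congr 1; push_cast; ring
  simp only [Pi.zero_apply, this] at hx
  have h1 : (1 - Real.exp (1 / 2 * l x)) ^ 2 = 0 := by linarith
  have h2 : Real.exp (1 / 2 * l x) = 1 := by nlinarith [pow_eq_zero_iff (two_ne_zero) |>.1 h1]
  have h3 := (Real.exp_eq_one_iff _).1 h2
  simp only [Pi.zero_apply]
  linarith

theorem one_le_expMoment_of_notMem (H : IsLogRatio p q l) (hne : ¬ l =ᵐ[p] 0) {z : ℝ}
    (hz : z ∉ Set.Ioo (0 : ℝ) 1) : 1 ≤ expMoment p l z := by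
  by_cases hz0 : z ≤ 0
  · simpa using H.ofReal_exp_le_expMoment (t := 0) (by simpa using H.extExp_neg_of_not_ae_zero hne) hz0
  · have hz1 : 1 ≤ z := by
      by_contra! h
      exact hz ⟨not_le.1 hz0, h⟩
    have h1 : extExp q (fun x => -l x) < (0 : ℝ) := by
      rw [extExp_neg (Or.inr H.symm.lintegral_ofReal_ne_top), EReal.coe_zero, EReal.neg_lt_comm]
      simpa using H.zero_lt_extExp_of_not_ae_zero hne
    have h2 := H.symm.ofReal_exp_le_expMoment h1 (z := 1 - z) (by linarith)
    rw [H.expMoment_symm] at h2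
    simpa using h2

theorem iSup_rate_le (H : IsLogRatio p q l) {t : ℝ} (ht : extExp p l < t) (ht0 : t ≤ 0) :
    ⨆ z : ℝ, ((z * t : ℝ) : EReal) - ENNReal.log (expMoment p l z)
      ≤ ⨆ z : ℝ, -ENNReal.log (expMoment p l z) := by
  refine iSup_le fun z => ?_
  rcases le_or_gt 0 z with hz | hz
  · refine le_trans ?_ (le_iSup _ z)
    rw [← zero_sub]
    refine EReal.sub_le_sub ?_ le_rfl
    exact_mod_cast mul_nonpos_of_nonneg_of_nonpos hz ht0
  · refine le_trans ?_ (le_iSup _ 0)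
    rw [expMoment_zero, ENNReal.log_one, neg_zero, EReal.sub_nonpos, ← log_ofReal_exp]
    exact ENNReal.log_le_log (H.ofReal_exp_le_expMoment ht hz.le)

end IsLogRatio

theorem rate_eq (μ : Measure ℝ) (g h : ℝ → ℝ) (t : ℝ) :
    rate μ g h t = ⨆ z : ℝ, ((z * t : ℝ) : EReal) - ENNReal.log (expMoment (law μ g) (llr g h) z) :=
  rfl

theorem llr_swap (g h : ℝ → ℝ) : llr h g = fun x => -llr g h x := by
  funext x; simp [llr]

/-- The Chernoff index is the supremum of `-log ∫ h^z g^(1-z)` over `0 < z < 1`. -/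
theorem chernoffIndex_eq {μ : Measure ℝ} {g h : ℝ → ℝ} [IsProbabilityMeasure (law μ g)]
    [IsProbabilityMeasure (law μ h)] (H : IsLogRatio (law μ g) (law μ h) (llr g h))
    (hne : ¬ llr g h =ᵐ[law μ g] 0) :
    chernoffIndex μ g h
      = ⨆ z ∈ Set.Ioo (0 : ℝ) 1, -ENNReal.log (expMoment (law μ g) (llr g h) z) := by
  set M := expMoment (law μ g) (llr g h) with hM
  have hMh : ∀ z, expMoment (law μ h) (llr h g) z = M (1 - z) := fun z => by
    rw [llr_swap]; exact H.expMoment_symm z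
  have hall : ⨆ z : ℝ, -ENNReal.log (M z) = ⨆ z ∈ Set.Ioo (0 : ℝ) 1, -ENNReal.log (M z) := by
    refine le_antisymm (iSup_le fun z => ?_) (iSup₂_le fun z _ => le_iSup (fun z => -ENNReal.log (M z)) z)
    by_cases hz : z ∈ Set.Ioo (0 : ℝ) 1
    · exact le_iSup₂ (f := fun z (_ : z ∈ Set.Ioo (0 : ℝ) 1) => -ENNReal.log (M z)) z hz
    · refine le_trans (b := 0) ?_ ?_
      · rw [EReal.neg_le, neg_zero, ENNReal.zero_le_log_iff]
        exact H.one_le_expMoment_of_notMem hne hz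
      · refine le_trans ?_ (le_iSup₂ (f := fun z (_ : z ∈ Set.Ioo (0 : ℝ) 1) =>
          -ENNReal.log (M z)) (1 / 2) ⟨by norm_num, by norm_num⟩)
        rw [EReal.le_neg, neg_zero, ENNReal.log_le_zero_iff]
        exact (H.expMoment_half_lt_one hne).le
  have hallh : ⨆ z : ℝ, -ENNReal.log (expMoment (law μ h) (llr h g) z)
      = ⨆ z : ℝ, -ENNReal.log (M z) := by
    simp only [hMh]
    exact (Equiv.subLeft (1 : ℝ)).iSup_congr fun z => rfl
  rw [← hall]
  refine le_antisymm (iSup₂_le fun t ht => ?_) ?_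
  · rcases le_total t 0 with ht0 | ht0
    · exact (min_le_left _ _).trans (H.iSup_rate_le ht.1 ht0)
    · refine (min_le_right _ _).trans ?_
      rw [← hallh]
      have H' : IsLogRatio (law μ h) (law μ g) (llr h g) := by rw [llr_swap]; exact H.symm
      refine H'.iSup_rate_le (t := -t) ?_ (by linarith)
      rw [llr_swap, extExp_neg (Or.inr H.symm.lintegral_ofReal_ne_top), EReal.coe_neg,
        EReal.neg_lt_neg_iff]
      exact ht.2
  · refine le_trans ?_ (le_iSup₂ (f := fun t _ => min (rate μ g h t) (rate μ h g (-t))) (0 : ℝ)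
      ⟨?_, ?_⟩)
    · rw [neg_zero, rate_eq, rate_eq]
      simp only [mul_zero, EReal.coe_zero, zero_sub]
      rw [hallh, ← hM, min_self]
    · simpa using H.extExp_neg_of_not_ae_zero hne
    · simpa using H.zero_lt_extExp_of_not_ae_zero hne

end SeparateFamilies

namespace SeparateFamilies

open ProbabilityTheory

section Product

variable {n : ℕ}

theorem lintegral_pi_prod (p : Measure ℝ) [IsProbabilityMeasure p] {f : Fin n → ℝ → ℝ≥0∞}
    (hf : ∀ i, Measurable (f i)) :
    ∫⁻ x, ∏ i, f i (x i) ∂(Measure.pi fun _ : Fin n => p) = ∏ i, ∫⁻ y, f i y ∂p := by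
  have hind : iIndepFun (fun i (x : Fin n → ℝ) => f i (x i)) (Measure.pi fun _ : Fin n => p) :=
    iIndepFun_pi fun i => (hf i).aemeasurable
  rw [lintegral_prod_eq_prod_lintegral_of_indepFun Finset.univ _ hind
    fun i => (hf i).comp (measurable_pi_apply i)]
  exact Finset.prod_congr rfl fun i _ =>
    (measurePreserving_eval (fun _ : Fin n => p) i).lintegral_comp (hf i)

theorem ofReal_exp_sum (l : ℝ → ℝ) (x : Fin n → ℝ) :
    ENNReal.ofReal (Real.exp (∑ i, l (x i))) = ∏ i, ENNReal.ofReal (Real.exp (l (x i))) := by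
  rw [Real.exp_sum, ENNReal.ofReal_prod_of_nonneg fun i _ => (Real.exp_pos _).le]

theorem IsLogRatio.pi {p q : Measure ℝ} {l : ℝ → ℝ} [IsProbabilityMeasure p]
    [IsProbabilityMeasure q] (H : IsLogRatio p q l) (n : ℕ) :
    (Measure.pi fun _ : Fin n => q) = (Measure.pi fun _ : Fin n => p).withDensity
      fun x => ENNReal.ofReal (Real.exp (∑ i, l (x i))) := by
  have hm := H.measurable
  refine Measure.pi_eq fun s hs => ?_
  rw [withDensity_apply _ (MeasurableSet.univ_pi hs), ← lintegral_indicator (MeasurableSet.univ_pi hs)]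
  have key : ∀ x : Fin n → ℝ, (Set.univ.pi s).indicator
      (fun x => ENNReal.ofReal (Real.exp (∑ i, l (x i)))) x
      = ∏ i, (s i).indicator (fun y => ENNReal.ofReal (Real.exp (l y))) (x i) := by
    intro x
    by_cases hx : x ∈ Set.univ.pi s
    · rw [Set.indicator_of_mem hx, ofReal_exp_sum]
      exact Finset.prod_congr rfl fun i _ => by rw [Set.indicator_of_mem (hx i (Set.mem_univ i))]
    · rw [Set.indicator_of_notMem hx]
      simp only [Set.mem_pi, Set.mem_univ, true_imp_iff, not_forall] at hx
      obtain ⟨i, hi⟩ := hx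
      exact (Finset.prod_eq_zero (Finset.mem_univ i) (Set.indicator_of_notMem hi _)).symm
  simp only [key]
  rw [lintegral_pi_prod p fun i => Measurable.indicator (by fun_prop) (hs i)]
  refine Finset.prod_congr rfl fun i _ => ?_
  rw [lintegral_indicator (hs i), H.eq_withDensity, withDensity_apply _ (hs i)]

theorem IsLogRatio.pi_absolutelyContinuous {p q : Measure ℝ} {l : ℝ → ℝ} [IsProbabilityMeasure p]
    [IsProbabilityMeasure q] (H : IsLogRatio p q l) (n : ℕ) :
    (Measure.pi fun _ : Fin n => q) ≪ Measure.pi fun _ : Fin n => p := by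
  rw [H.pi n]; exact withDensity_absolutelyContinuous _ _

/-- Change of measure on an event where the log-likelihood ratio is bounded below. -/
theorem IsLogRatio.mul_pi_le {p q : Measure ℝ} {l : ℝ → ℝ} [IsProbabilityMeasure p]
    [IsProbabilityMeasure q] (H : IsLogRatio p q l) {c : ℝ} {A : Set (Fin n → ℝ)}
    (hA : ∀ x ∈ A, c ≤ ∑ i, l (x i)) :
    ENNReal.ofReal (Real.exp c) * (Measure.pi fun _ : Fin n => p) A
      ≤ (Measure.pi fun _ : Fin n => q) A := by
  have hm := H.measurable
  have hB : MeasurableSet {x : Fin n → ℝ | c ≤ ∑ i, l (x i)} :=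
    measurableSet_le measurable_const
      (Finset.measurable_sum _ fun i _ => hm.comp (measurable_pi_apply i))
  rw [H.pi n, withDensity_apply', ← setLIntegral_const]
  refine lintegral_mono_ae (ae_restrict_of_ae_restrict_of_subset (show A ⊆ _ from hA) ?_)
  filter_upwards [ae_restrict_mem hB] with x hx
  exact ENNReal.ofReal_le_ofReal (Real.exp_le_exp.2 hx)

/-- The exponential Markov inequality for sums. -/
theorem pi_sum_ge_le (p : Measure ℝ) [IsProbabilityMeasure p] {l : ℝ → ℝ} (hl : Measurable l)
    {z : ℝ} (hz : 0 ≤ z) (c : ℝ) :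
    (Measure.pi fun _ : Fin n => p) {x | -c ≤ ∑ i, l (x i)}
      ≤ ENNReal.ofReal (Real.exp (z * c)) * expMoment p l z ^ n := by
  have hmeas : Measurable fun x : Fin n → ℝ => ENNReal.ofReal (Real.exp (∑ i, z * l (x i))) := by
    refine ENNReal.measurable_ofReal.comp (Real.measurable_exp.comp ?_)
    exact Finset.measurable_sum _ fun i _ => (hl.comp (measurable_pi_apply i)).const_mul z
  have hI : ∫⁻ x, ENNReal.ofReal (Real.exp (∑ i, z * l (x i))) ∂(Measure.pi fun _ : Fin n => p)
      = expMoment p l z ^ n := by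
    simp only [ofReal_exp_sum (fun y => z * l y)]
    rw [lintegral_pi_prod p (f := fun _ y => ENNReal.ofReal (Real.exp (z * l y)))
      fun i => by fun_prop]
    simp [expMoment]
  have h1 := mul_meas_ge_le_lintegral₀ (μ := Measure.pi fun _ : Fin n => p) hmeas.aemeasurable
    (ENNReal.ofReal (Real.exp (-(z * c))))
  rw [hI] at h1
  have h2 : ENNReal.ofReal (Real.exp (z * c)) * ENNReal.ofReal (Real.exp (-(z * c))) = 1 := by
    rw [← ENNReal.ofReal_mul (Real.exp_nonneg _), ← Real.exp_add]; simp
  calc (Measure.pi fun _ : Fin n => p) {x | -c ≤ ∑ i, l (x i)}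
      ≤ (Measure.pi fun _ : Fin n => p) {x | ENNReal.ofReal (Real.exp (-(z * c)))
          ≤ ENNReal.ofReal (Real.exp (∑ i, z * l (x i)))} := by
        refine measure_mono fun x hx => ENNReal.ofReal_le_ofReal (Real.exp_le_exp.2 ?_)
        rw [← Finset.mul_sum, ← mul_neg]
        exact mul_le_mul_of_nonneg_left hx hz
    _ = ENNReal.ofReal (Real.exp (z * c)) * (ENNReal.ofReal (Real.exp (-(z * c))) *
          (Measure.pi fun _ : Fin n => p) {x | ENNReal.ofReal (Real.exp (-(z * c)))
          ≤ ENNReal.ofReal (Real.exp (∑ i, z * l (x i)))}) := by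
        rw [← mul_assoc, h2, one_mul]
    _ ≤ _ := by gcongr

/-- The weak law of large numbers for square integrable variables on finite products. -/
theorem eventually_half_le_pi (Q : Measure ℝ) [IsProbabilityMeasure Q] {l : ℝ → ℝ}
    (hl : MemLp l 2 Q) {ε : ℝ} (hε : 0 < ε) :
    ∀ᶠ n : ℕ in atTop, ENNReal.ofReal (1 / 2) ≤ (Measure.pi fun _ : Fin n => Q)
      {x | |∑ i, l (x i) - n * ∫ y, l y ∂Q| < n * ε} := by
  obtain ⟨N, hN⟩ := exists_nat_gt (2 * Var[l; Q] / ε ^ 2)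
  filter_upwards [eventually_ge_atTop (max N 1)] with n hn
  have hn1 : (1 : ℝ) ≤ n := by exact_mod_cast (le_max_right _ _).trans hn
  have hnN : (N : ℝ) ≤ n := by exact_mod_cast (le_max_left _ _).trans hn
  set P := Measure.pi fun _ : Fin n => Q with hP
  have hmp : ∀ i : Fin n, MemLp (fun x : Fin n → ℝ => l (x i)) 2 P := fun i =>
    hl.comp_measurePreserving (measurePreserving_eval (fun _ : Fin n => Q) i)
  have hS : MemLp (∑ i, fun x : Fin n → ℝ => l (x i)) 2 P := memLp_finsetSum' _ fun i _ => hmp i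
  have hmean : P[∑ i, fun x : Fin n → ℝ => l (x i)] = n * ∫ y, l y ∂Q := by
    simp only [Finset.sum_apply]
    rw [integral_finsetSum _ fun i _ => (hmp i).integrable one_le_two]
    have : ∀ i : Fin n, ∫ x, l (x i) ∂P = ∫ y, l y ∂Q := fun i => by
      have h1 := (measurePreserving_eval (fun _ : Fin n => Q) i).map_eq
      have h2 := integral_map (μ := P) (φ := Function.eval i) (f := l)
        (measurable_pi_apply i).aemeasurable (by rw [h1]; exact hl.aestronglyMeasurable)
      rw [h1] at h2
      exact h2.symm
    simp [this]
  have hvar : Var[∑ i, fun x : Fin n → ℝ => l (x i); P] = n * Var[l; Q] := by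
    rw [variance_sum_pi (fun _ => hl)]; simp
  have hcheb := meas_ge_le_variance_div_sq hS (c := n * ε) (by positivity)
  rw [hmean, hvar] at hcheb
  simp only [Finset.sum_apply] at hcheb
  have hbound : n * Var[l; Q] / (n * ε) ^ 2 ≤ 1 / 2 := by
    rw [div_le_div_iff₀ (by positivity) (by norm_num), mul_pow]
    have h1 : 2 * Var[l; Q] < n * ε ^ 2 := by
      rw [← div_lt_iff₀ (by positivity)]; exact hN.trans_le hnN
    nlinarith
  have hcompl : P {x | |∑ i, l (x i) - n * ∫ y, l y ∂Q| < n * ε}ᶜ ≤ ENNReal.ofReal (1 / 2) := by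
    refine le_trans (le_of_eq ?_) (hcheb.trans (ENNReal.ofReal_le_ofReal hbound))
    congr 1
    ext x
    simp
  have htot : (1 : ℝ≥0∞) ≤ P {x | |∑ i, l (x i) - n * ∫ y, l y ∂Q| < n * ε}
      + ENNReal.ofReal (1 / 2) := by
    rw [← measure_univ (μ := P), ← Set.union_compl_self {x | |∑ i, l (x i) - n * ∫ y, l y ∂Q| < n * ε}]
    exact (measure_union_le _ _).trans (by gcongr)
  have hone : (1 : ℝ≥0∞) = ENNReal.ofReal (1 / 2) + ENNReal.ofReal (1 / 2) := by
    rw [← ENNReal.ofReal_add (by norm_num) (by norm_num)]; norm_num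
  rw [hone] at htot
  exact (ENNReal.add_le_add_iff_right ENNReal.ofReal_ne_top).1 htot

end Product

namespace IsLogRatio

variable {p q : Measure ℝ} {l : ℝ → ℝ} [IsProbabilityMeasure p] [IsProbabilityMeasure q]

theorem Icc_subset_integrableExpSet (H : IsLogRatio p q l) :
    Set.Icc (0 : ℝ) 1 ⊆ integrableExpSet l p := by
  have h0 : (0 : ℝ) ∈ integrableExpSet l p := by simp [integrableExpSet]
  have h1 : (1 : ℝ) ∈ integrableExpSet l p := by simpa [integrableExpSet] using H.integrable_exp
  have := convex_integrableExpSet.segment_subset h0 h1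
  rwa [segment_eq_Icc zero_le_one] at this

theorem Ioo_subset_interior (H : IsLogRatio p q l) :
    Set.Ioo (0 : ℝ) 1 ⊆ interior (integrableExpSet l p) :=
  interior_maximal (Set.Ioo_subset_Icc_self.trans H.Icc_subset_integrableExpSet) isOpen_Ioo

theorem expMoment_eq_exp_cgf (H : IsLogRatio p q l) {z : ℝ} (hz : z ∈ Set.Icc (0 : ℝ) 1) :
    expMoment p l z = ENNReal.ofReal (Real.exp (cgf l p z)) := by
  have hi : Integrable (fun x => Real.exp (z * l x)) p := H.Icc_subset_integrableExpSet hz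
  rw [cgf, Real.exp_log (mgf_pos hi), mgf, expMoment,
    ofReal_integral_eq_lintegral_ofReal hi (ae_of_all _ fun x => (Real.exp_pos _).le)]

theorem continuousOn_cgf (H : IsLogRatio p q l) : ContinuousOn (cgf l p) (Set.Icc 0 1) := by
  have hm := H.measurable
  have hmgf : ContinuousOn (mgf l p) (Set.Icc 0 1) := by
    refine continuousOn_of_dominated (bound := fun x => 1 + Real.exp (l x)) ?_ ?_ ?_ ?_
    · intro z _; fun_prop
    · intro z hz
      refine ae_of_all _ fun x => ?_
      rw [Real.norm_eq_abs, abs_of_pos (Real.exp_pos _)]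
      rcases le_total (l x) 0 with h | h
      · have : Real.exp (z * l x) ≤ 1 :=
          Real.exp_le_one_iff.2 (mul_nonpos_of_nonneg_of_nonpos hz.1 h)
        linarith [Real.exp_pos (l x)]
      · have : Real.exp (z * l x) ≤ Real.exp (l x) :=
          Real.exp_le_exp.2 (mul_le_of_le_one_left h hz.2)
        linarith
    · exact (integrable_const _).add H.integrable_exp
    · exact ae_of_all _ fun x => Continuous.continuousOn (by fun_prop)
  exact hmgf.log fun z hz => ne_of_gt (mgf_pos (H.Icc_subset_integrableExpSet hz))

/-- Every mean close to `0` is attained by an exponential tilt with parameter in `(0, 1)`. -/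
theorem exists_deriv_cgf_eq (H : IsLogRatio p q l) (hne : ¬ l =ᵐ[p] 0) :
    ∃ c > (0 : ℝ), ∀ δ : ℝ, |δ| < c → ∃ z ∈ Set.Ioo (0 : ℝ) 1, deriv (cgf l p) z = δ := by
  have hdiff : ∀ z ∈ Set.Ioo (0 : ℝ) 1, DifferentiableAt ℝ (cgf l p) z := fun z hz =>
    (analyticAt_cgf (H.Ioo_subset_interior hz)).differentiableAt
  have h0 : cgf l p 0 = 0 := by simp
  have h1 : cgf l p 1 = 0 := by
    have := H.integral_exp
    simp [cgf, mgf, this]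
  have hhalf : cgf l p (1 / 2) < 0 := by
    have := H.expMoment_half_lt_one hne
    rw [H.expMoment_eq_exp_cgf ⟨by norm_num, by norm_num⟩, ENNReal.ofReal_lt_one,
      Real.exp_lt_one_iff] at this
    exact this
  obtain ⟨z₁, hz₁, e₁⟩ := exists_deriv_eq_slope (cgf l p) (show (0 : ℝ) < 1 / 2 by norm_num)
    (H.continuousOn_cgf.mono (Set.Icc_subset_Icc le_rfl (by norm_num)))
    fun z hz => (hdiff z ⟨hz.1, hz.2.trans (by norm_num)⟩).differentiableWithinAt
  obtain ⟨z₂, hz₂, e₂⟩ := exists_deriv_eq_slope (cgf l p) (show (1 / 2 : ℝ) < 1 by norm_num)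
    (H.continuousOn_cgf.mono (Set.Icc_subset_Icc (by norm_num) le_rfl))
    fun z hz => (hdiff z ⟨lt_trans (by norm_num) hz.1, hz.2⟩).differentiableWithinAt
  have hz₁' : z₁ ∈ Set.Ioo (0 : ℝ) 1 := ⟨hz₁.1, hz₁.2.trans (by norm_num)⟩
  have hz₂' : z₂ ∈ Set.Ioo (0 : ℝ) 1 := ⟨lt_trans (by norm_num) hz₂.1, hz₂.2⟩
  refine ⟨-2 * cgf l p (1 / 2), by linarith, fun δ hδ => ?_⟩
  rw [abs_lt] at hδ
  have hconn := Set.OrdConnected.image_deriv (Set.ordConnected_Ioo (a := (0 : ℝ)) (b := 1)) hdiff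
  have hmem := hconn.out (Set.mem_image_of_mem _ hz₁') (Set.mem_image_of_mem _ hz₂')
    (show δ ∈ Set.Icc _ _ from ⟨?_, ?_⟩)
  · obtain ⟨z, hz, rfl⟩ := hmem
    exact ⟨z, hz, rfl⟩
  · rw [e₁, h0, show (1 / 2 - 0 : ℝ) = 2⁻¹ by norm_num, div_inv_eq_mul]; linarith
  · rw [e₂, h1, show (1 - 1 / 2 : ℝ) = 2⁻¹ by norm_num, div_inv_eq_mul]; linarith

theorem tilted (H : IsLogRatio p q l) {z : ℝ} (hz : z ∈ Set.Ioo (0 : ℝ) 1) :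
    IsLogRatio p (p.tilted (fun x => z * l x)) (fun x => z * l x - cgf l p z) := by
  have hm := H.measurable
  have hi : Integrable (fun x => Real.exp (z * l x)) p :=
    H.Icc_subset_integrableExpSet (Set.Ioo_subset_Icc_self hz)
  refine ⟨by fun_prop, ?_⟩
  rw [Measure.tilted]
  congr 1
  funext x
  rw [Real.exp_sub, exp_cgf hi, mgf]

/-- Cramér's lower bound, by exponential tilting. -/
theorem eventually_le_pi_window (H : IsLogRatio p q l) {z : ℝ} (hz : z ∈ Set.Ioo (0 : ℝ) 1)
    {ε : ℝ} (hε : 0 < ε) :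
    ∀ᶠ n : ℕ in atTop,
      ENNReal.ofReal (Real.exp (n * (cgf l p z - z * (deriv (cgf l p) z + ε))) / 2)
        ≤ (Measure.pi fun _ : Fin n => p)
          {x | |∑ i, l (x i) - n * deriv (cgf l p) z| < n * ε} := by
  have hzi := H.Ioo_subset_interior hz
  have hi : Integrable (fun x => Real.exp (z * l x)) p :=
    H.Icc_subset_integrableExpSet (Set.Ioo_subset_Icc_self hz)
  have : IsProbabilityMeasure (p.tilted fun x => z * l x) := isProbabilityMeasure_tilted hi
  filter_upwards [eventually_half_le_pi (p.tilted fun x => z * l x)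
    (memLp_tilted_mul hzi 2) hε] with n hn
  rw [integral_tilted_mul_self hzi] at hn
  set W := {x : Fin n → ℝ | |∑ i, l (x i) - n * deriv (cgf l p) z| < n * ε} with hW
  refine le_trans ?_ ((H.tilted hz).symm.mul_pi_le (A := W)
    (c := n * (cgf l p z - z * (deriv (cgf l p) z + ε))) fun x hx => ?_)
  · rw [div_eq_mul_one_div, ENNReal.ofReal_mul (Real.exp_nonneg _)]
    gcongr
  · have h1 := (abs_lt.1 (show |∑ i, l (x i) - n * deriv (cgf l p) z| < n * ε from hx)).2
    have h2 : ∑ i, -(z * l (x i) - cgf l p z) = n * cgf l p z - z * ∑ i, l (x i) := by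
      simp only [neg_sub, Finset.sum_sub_distrib, Finset.mul_sum]
      simp
    rw [h2]
    have h3 := mul_le_mul_of_nonneg_left h1.le hz.1.le
    linarith

end IsLogRatio

end SeparateFamilies

namespace SeparateFamilies

section Densities

variable {μ : Measure ℝ} {g h : ℝ → ℝ}

theorem IsDensity.isProbabilityMeasure_law (hg : IsDensity μ g) : IsProbabilityMeasure (law μ g) :=
  ⟨by rw [law, withDensity_apply _ MeasurableSet.univ, Measure.restrict_univ, hg.lintegral_eq_one]⟩

theorem IsDensity.ae_pos (hg : IsDensity μ g) : ∀ᵐ x ∂law μ g, 0 < g x := by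
  rw [law, ae_withDensity_iff (by have := hg.measurable; fun_prop)]
  refine ae_of_all _ fun x hx => ?_
  by_contra! hcon
  exact hx (ENNReal.ofReal_of_nonpos hcon)

theorem IsDensity.isLogRatio (hg : IsDensity μ g) (hh : IsDensity μ h)
    (hgh : law μ g ≪ law μ h) (hhg : law μ h ≪ law μ g) :
    IsLogRatio (law μ g) (law μ h) (llr g h) := by
  have hgm := hg.measurable
  have hhm := hh.measurable
  have hlm : Measurable (llr g h) := by unfold llr; fun_prop
  refine ⟨hlm, ?_⟩
  have h1 : ∀ᵐ x ∂law μ g, 0 < h x := hgh.ae_le hh.ae_pos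
  have h2 : ∀ᵐ x ∂law μ h, 0 < g x := hhg.ae_le hg.ae_pos
  rw [law, ae_withDensity_iff (by fun_prop)] at h1 h2
  rw [law, law, ← withDensity_mul₀ (by fun_prop) (by fun_prop)]
  refine withDensity_congr_ae ?_
  filter_upwards [h1, h2] with x hx1 hx2
  rw [Pi.mul_apply, ← ENNReal.ofReal_mul (hg.nonneg x)]
  congr 1
  by_cases hgx : g x = 0
  · have : h x = 0 := by
      by_contra hne
      have hpos := (hh.nonneg x).lt_of_ne (Ne.symm hne)
      exact (hx2 (ENNReal.ofReal_pos.2 hpos).ne').ne' hgx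
    rw [this, hgx, zero_mul]
  · have hgpos := (hg.nonneg x).lt_of_ne (Ne.symm hgx)
    have hhpos := hx1 (ENNReal.ofReal_pos.2 hgpos).ne'
    rw [llr, Real.exp_sub, Real.exp_log hhpos, Real.exp_log hgpos]
    field_simp

theorem CompleteSeparation.not_ae_zero {d : ℕ} {h : EuclideanSpace ℝ (Fin d) → ℝ → ℝ}
    {Γ : Set (EuclideanSpace ℝ (Fin d))} (hA1 : CompleteSeparation μ g h Γ)
    {γ : EuclideanSpace ℝ (Fin d)} (hγ : γ ∈ Γ) : ¬ llr g (h γ) =ᵐ[law μ g] 0 := by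
  intro hzero
  have hpos : 0 < extExp (law μ g) fun x => Real.log (g x) - Real.log (h γ x) :=
    hA1.trans_le (iInf₂_le γ hγ)
  have e1 : ∫⁻ x, ENNReal.ofReal (Real.log (g x) - Real.log (h γ x)) ∂(law μ g) = 0 := by
    rw [← lintegral_zero (μ := law μ g)]
    refine lintegral_congr_ae ?_
    filter_upwards [hzero] with x hx
    simp only [llr, Pi.zero_apply] at hx
    exact ENNReal.ofReal_of_nonpos (by linarith)
  rw [extExp, e1, EReal.coe_ennreal_zero, zero_sub] at hpos
  have h0 := EReal.coe_ennreal_nonneg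
    (∫⁻ x, ENNReal.ofReal (-(Real.log (g x) - Real.log (h γ x))) ∂(law μ g))
  exact absurd hpos (by rw [not_lt, EReal.neg_le, neg_zero]; exact h0)

end Densities

section Semicontinuity

/-- Under pointwise continuity of log-likelihood ratios, Fatou's lemma gives lower semicontinuity. -/
theorem lowerSemicontinuous_neg_log_expMoment {ι : Type*} [TopologicalSpace ι]
    [FirstCountableTopology ι] {p : Measure ℝ} [IsProbabilityMeasure p] {q : ι → Measure ℝ}
    [∀ i, IsProbabilityMeasure (q i)] {l : ι → ℝ → ℝ} (H : ∀ i, IsLogRatio p (q i) (l i))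
    (hc : ∀ᵐ x ∂p, Continuous fun i => l i x) {z : ℝ} (hz : z ∈ Set.Ioo (0 : ℝ) 1) :
    LowerSemicontinuous fun i => -ENNReal.log (expMoment p (l i) z) := by
  have hm := fun i => (H i).measurable
  have hz1 : 0 ≤ 1 - z := by linarith [hz.2]
  set F : ι → ℝ → ℝ≥0∞ := fun i x =>
    ENNReal.ofReal (z * Real.exp (l i x) + (1 - z) - Real.exp (z * l i x)) with hF
  have hFm : ∀ i, Measurable (F i) := fun i => by have := hm i; simp only [hF]; fun_prop
  have hsum : ∀ i, expMoment p (l i) z + ∫⁻ x, F i x ∂p = 1 := by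
    intro i
    have hmi := hm i
    rw [expMoment, ← lintegral_add_left (by fun_prop)]
    have hpt : ∀ x, ENNReal.ofReal (Real.exp (z * l i x)) + F i x
        = ENNReal.ofReal z * ENNReal.ofReal (Real.exp (l i x)) + ENNReal.ofReal (1 - z) := by
      intro x
      have hconv := convexOn_exp.2 (Set.mem_univ (l i x)) (Set.mem_univ 0) hz.1.le hz1 (by ring)
      simp only [smul_eq_mul, mul_zero, add_zero, Real.exp_zero, mul_one] at hconv
      rw [hF, ← ENNReal.ofReal_add (Real.exp_nonneg _) (by linarith), ← ENNReal.ofReal_mul hz.1.le,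
        ← ENNReal.ofReal_add (mul_nonneg hz.1.le (Real.exp_nonneg _)) hz1]
      congr 1; ring
    simp only [hpt]
    rw [lintegral_add_right _ measurable_const, lintegral_const_mul _ (by fun_prop),
      (H i).lintegral_exp, lintegral_const, measure_univ, mul_one, mul_one,
      ← ENNReal.ofReal_add hz.1.le hz1]
    simp
  have hM : ∀ i, expMoment p (l i) z = 1 - ∫⁻ x, F i x ∂p := fun i => by
    refine ENNReal.eq_sub_of_add_eq ?_ (hsum i)
    refine ne_top_of_le_ne_top ENNReal.one_ne_top ?_
    rw [← hsum i]; exact le_add_self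
  have hlsc : LowerSemicontinuous fun i => ∫⁻ x, F i x ∂p := by
    rw [lowerSemicontinuous_iff_le_liminf]
    intro i
    refine le_trans (le_of_eq (lintegral_congr_ae ?_)) (lintegral_liminf_le hFm)
    filter_upwards [hc] with x hx
    refine (Tendsto.liminf_eq (f := 𝓝 i) ?_).symm
    have : Continuous fun j => F j x := by
      simp only [hF]
      exact ENNReal.continuous_ofReal.comp (by fun_prop)
    exact this.tendsto i
  have hφ : Continuous fun u : ℝ≥0∞ => -ENNReal.log (1 - u) :=
    continuous_neg.comp (ENNReal.continuous_log.comp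
      (ENNReal.continuous_sub_left ENNReal.one_ne_top))
  have hmono : Monotone fun u : ℝ≥0∞ => -ENNReal.log (1 - u) := fun u v huv =>
    EReal.neg_le_neg_iff.2 (ENNReal.log_le_log (tsub_le_tsub_left huv _))
  simp only [hM]
  exact hφ.comp_lowerSemicontinuous hlsc hmono

end Semicontinuity

section Region

variable {d : ℕ} {g : ℝ → ℝ} {h : EuclideanSpace ℝ (Fin d) → ℝ → ℝ}
  {Γ : Set (EuclideanSpace ℝ (Fin d))}

theorem prod_eq_exp_sum_llr_mul {n : ℕ} {x : Fin n → ℝ} {γ : EuclideanSpace ℝ (Fin d)}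
    (hg : ∀ i, 0 < g (x i)) (hh : ∀ i, 0 < h γ (x i)) :
    ∏ i, h γ (x i) = Real.exp (∑ i, llr g (h γ) (x i)) * ∏ i, g (x i) := by
  rw [Real.exp_sum, ← Finset.prod_mul_distrib]
  refine Finset.prod_congr rfl fun i _ => ?_
  rw [llr, Real.exp_sub, Real.exp_log (hh i), Real.exp_log (hg i), div_mul_cancel₀ _ (hg i).ne']

theorem mem_rejectionRegion_iff (hΓne : Γ.Nonempty) (hΓc : IsCompact Γ) {n : ℕ} {x : Fin n → ℝ}
    (hg : ∀ i, 0 < g (x i)) (hh : ∀ i, ∀ γ ∈ Γ, 0 < h γ (x i))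
    (hc : ∀ i, ContinuousOn (fun γ => llr g (h γ) (x i)) Γ) :
    x ∈ rejectionRegion g h Γ 1 n ↔ ∃ γ ∈ Γ, 0 < ∑ i, llr g (h γ) (x i) := by
  have hG : 0 < ∏ i, g (x i) := Finset.prod_pos fun i _ => hg i
  have : Nonempty Γ := hΓne.to_subtype
  have hprod : ∀ γ : Γ, ∏ i, h γ (x i)
      = Real.exp (∑ i, llr g (h γ) (x i)) * ∏ i, g (x i) := fun γ =>
    prod_eq_exp_sum_llr_mul hg fun i => hh i γ γ.2
  have hbdd : BddAbove (Set.range fun γ : Γ => ∏ i, h γ (x i)) := by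
    have hcont : ContinuousOn
        (fun γ => Real.exp (∑ i, llr g (h γ) (x i)) * ∏ i, g (x i)) Γ :=
      (Real.continuous_exp.comp_continuousOn
        (continuousOn_finsetSum _ fun i _ => hc i)).mul continuousOn_const
    obtain ⟨B, hB⟩ := hΓc.bddAbove_image hcont
    refine ⟨B, ?_⟩
    rintro _ ⟨γ, rfl⟩
    simp only [hprod]
    exact hB ⟨γ, γ.2, rfl⟩
  rw [rejectionRegion, Set.mem_ofPred_eq, glr, one_lt_div hG, lt_ciSup_iff hbdd]
  simp only [hprod, lt_mul_iff_one_lt_left hG, Real.one_lt_exp_iff, Subtype.exists, exists_prop]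

theorem norm_fderivWithin_le_of_gradSup_le {y X : ℝ} (hX : 0 ≤ X)
    (hS : gradSup g h Γ y ≤ ENNReal.ofReal X) {γ : EuclideanSpace ℝ (Fin d)} (hγ : γ ∈ Γ) :
    ‖fderivWithin ℝ (fun γ' => llr g (h γ') y) Γ γ‖ ≤ X := by
  have h1 := (le_iSup₂ (f := fun γ (_ : γ ∈ Γ) =>
    ‖gradientWithin (fun γ' => llr g (h γ') y) Γ γ‖ₑ) γ hγ).trans hS
  rw [← ofReal_norm, ENNReal.ofReal_le_ofReal_iff hX, gradientWithin,
    LinearIsometryEquiv.norm_map] at h1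
  exact h1

end Region

theorem eventually_mul_le_rpow {κ η : ℝ} (hκ : 0 < κ) (hη : 0 < η) (K : ℝ) :
    ∀ᶠ n : ℕ in atTop, K * n ≤ (κ * n) ^ (1 + η) := by
  have ht : Tendsto (fun n : ℕ => (κ * n : ℝ) ^ η) atTop atTop :=
    (tendsto_rpow_atTop hη).comp (tendsto_natCast_atTop_atTop.const_mul_atTop hκ)
  filter_upwards [ht.eventually_ge_atTop (K / κ), eventually_ge_atTop 1] with n hn hn1
  have hpos : (0 : ℝ) < κ * n := by positivity
  rw [Real.rpow_add hpos, Real.rpow_one]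
  rw [div_le_iff₀ hκ] at hn
  have : (0 : ℝ) ≤ n := Nat.cast_nonneg n
  nlinarith

theorem eventually_le_exp_mul (A : ℝ) {ε : ℝ} (hε : 0 < ε) :
    ∀ᶠ n : ℕ in atTop, A ≤ Real.exp (n * ε) := by
  have ht : Tendsto (fun n : ℕ => Real.exp (n * ε)) atTop atTop :=
    Real.tendsto_exp_atTop.comp (tendsto_natCast_atTop_atTop.atTop_mul_const hε)
  exact ht.eventually_ge_atTop A

theorem pi_eval_preimage_le (p : Measure ℝ) [IsProbabilityMeasure p] {n : ℕ} (i : Fin n)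
    (T : Set ℝ) : (Measure.pi fun _ : Fin n => p) {x | x i ∈ T} ≤ p T := by
  have h1 := (measurePreserving_eval (fun _ : Fin n => p) i)
  refine (Measure.le_map_apply h1.measurable.aemeasurable T).trans ?_
  rw [h1.map_eq]

theorem ae_pi_forall {p : Measure ℝ} [IsProbabilityMeasure p] {P : ℝ → Prop}
    (hP : ∀ᵐ y ∂p, P y) (n : ℕ) : ∀ᵐ x ∂(Measure.pi fun _ : Fin n => p), ∀ i, P (x i) :=
  ae_all_iff.2 fun i => (Measure.tendsto_eval_ae_ae (μ := fun _ : Fin n => p) (i := i)).eventually hP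

section TypeOne

variable {d : ℕ} {μ : Measure ℝ} {g : ℝ → ℝ} {h : EuclideanSpace ℝ (Fin d) → ℝ → ℝ}
  {Γ : Set (EuclideanSpace ℝ (Fin d))}

theorem ae_mem_rejectionRegion_iff (hg : IsDensity μ g) (hΓne : Γ.Nonempty) (hΓc : IsCompact Γ)
    (hA3 : GradientTail μ g h Γ) (n : ℕ) :
    ∀ᵐ x ∂sampleLaw μ g n,
      (x ∈ rejectionRegion g h Γ 1 n ↔ ∃ γ ∈ Γ, 0 < ∑ i, llr g (h γ) (x i)) := by
  have := hg.isProbabilityMeasure_law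
  filter_upwards [ae_pi_forall hg.ae_pos n, ae_pi_forall hA3.1 n] with x hx1 hx2
  exact mem_rejectionRegion_iff hΓne hΓc hx1 (fun i => (hx2 i).1) fun i => (hx2 i).2.continuousOn

/-- Exponential bound for the probability of a false rejection: a union bound over an exponentially
fine cover of `Γ`. -/
theorem eventually_sampleLaw_rejectionRegion_le (hg : IsDensity μ g)
    (hm : ∀ γ ∈ Γ, Measurable (llr g (h γ))) (hΓne : Γ.Nonempty) (hΓc : IsCompact Γ)
    (hΓb : HasC1Boundary Γ) (hA3 : GradientTail μ g h Γ) {r : ℝ}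
    (hr : ∀ γ ∈ Γ, ∃ z ∈ Set.Ioo (0 : ℝ) 1,
      expMoment (law μ g) (llr g (h γ)) z ≤ ENNReal.ofReal (Real.exp (-r)))
    {ε : ℝ} (hε : 0 < ε) :
    ∀ᶠ n : ℕ in atTop, sampleLaw μ g n (rejectionRegion g h Γ 1 n)
      ≤ ENNReal.ofReal (Real.exp (-(n * (r - ε)))) := by
  have := hg.isProbabilityMeasure_law
  obtain ⟨C, hC, r₀, hr₀, hlip⟩ := exists_local_lipschitz hΓc hΓb
  obtain ⟨A, hA, hcover⟩ := exists_cover_card_le hΓc.isBounded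
  obtain ⟨η, hη, x₀, hx₀, htail⟩ := hA3.2
  obtain ⟨γ₀, hγ₀⟩ := hΓne
  set κ : ℝ := ε / (4 * (d + 1)) with hκ
  have hκ0 : 0 < κ := by positivity
  have hκd : 2 * κ * d ≤ ε / 2 := by
    have h4 : 4 * κ * (d + 1) = ε := by rw [hκ]; field_simp
    nlinarith
  filter_upwards [eventually_le_exp_mul (x₀ + 1) hκ0, eventually_le_exp_mul (1 / r₀ + 1) hκ0,
    eventually_le_exp_mul (C / (κ / 2)) (half_pos hκ0),
    eventually_mul_le_rpow hκ0 hη (r - ε + 2), eventually_le_exp_mul (2 * (A * Real.exp 1)) (half_pos hε),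
    eventually_ge_atTop 1] with n hn1 hn2 hn3 hn4 hn5 hn6
  have hn6' : (1 : ℝ) ≤ n := by exact_mod_cast hn6
  set X := Real.exp (n * κ) with hX
  set δ := Real.exp (-(2 * (n * κ))) with hδ
  have hX1 : 1 ≤ X := Real.one_le_exp (by positivity)
  have hXδ : X * δ = Real.exp (-(n * κ)) := by rw [hX, hδ, ← Real.exp_add]; congr 1; ring
  have hδX : δ ≤ 1 / X := by
    rw [hδ, hX, one_div, ← Real.exp_neg]; exact Real.exp_le_exp.2 (by nlinarith)
  have hδr : δ < r₀ := by
    refine hδX.trans_lt ?_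
    rw [div_lt_comm₀ (by linarith) hr₀]; linarith
  have hsmall : n * (C * X * δ) ≤ 1 := by
    have e1 : n * (C * X * δ) = C * n * Real.exp (-(n * κ)) := by rw [← hXδ]; ring
    have e2 : X = Real.exp (n * (κ / 2)) * Real.exp (n * (κ / 2)) := by
      rw [hX, ← Real.exp_add]; congr 1; ring
    have h1 : n * (κ / 2) ≤ Real.exp (n * (κ / 2)) := by linarith [Real.add_one_le_exp (n * (κ / 2))]
    have h2 : C * n ≤ X := by
      rw [e2]
      calc C * n = C / (κ / 2) * (n * (κ / 2)) := by field_simp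
        _ ≤ _ := by gcongr
    rw [e1, Real.exp_neg, ← hX, ← div_eq_mul_inv, div_le_one (by linarith)]
    exact h2
  obtain ⟨t, htΓ, htcov, htcard⟩ := hcover δ (Real.exp_pos _) (hδX.trans (by
    rw [div_le_one (by linarith)]; exact hX1))
  set T : Set ℝ := {y | ENNReal.ofReal X < gradSup g h Γ y} with hT
  set P := sampleLaw μ g n with hP
  have hae : ∀ᵐ x ∂P, x ∈ rejectionRegion g h Γ 1 n →
      x ∈ (⋃ i : Fin n, {x | x i ∈ T}) ∪ ⋃ a ∈ t, {x | -1 ≤ ∑ i, llr g (h a) (x i)} := by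
    filter_upwards [ae_mem_rejectionRegion_iff hg ⟨γ₀, hγ₀⟩ hΓc hA3 n, ae_pi_forall hA3.1 n]
      with x hx1 hx2 hxR
    by_cases hxT : ∃ i, x i ∈ T
    · exact Or.inl (Set.mem_iUnion.2 hxT)
    right
    push Not at hxT
    obtain ⟨γ, hγ, hpos⟩ := hx1.1 hxR
    obtain ⟨a, ha, hadist⟩ := htcov γ hγ
    refine Set.mem_iUnion₂.2 ⟨a, ha, ?_⟩
    have hterm : ∀ i, llr g (h γ) (x i) - C * X * δ ≤ llr g (h a) (x i) := by
      intro i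
      have hS : gradSup g h Γ (x i) ≤ ENNReal.ofReal X := not_lt.1 (hxT i)
      have h1 := hlip a (htΓ a ha) γ hγ (hadist.trans hδr) (fun γ' => llr g (h γ') (x i)) X
        (by linarith) (hx2 i).2 fun y hy => norm_fderivWithin_le_of_gradSup_le (by linarith) hS hy
      have h2 : C * X * ‖γ - a‖ ≤ C * X * δ := by
        have : ‖γ - a‖ ≤ δ := by rw [← dist_eq_norm, dist_comm]; exact hadist.le
        gcongr
      linarith [(abs_le.1 h1).2]
    have hsum := Finset.sum_le_sum fun i (_ : i ∈ Finset.univ) => hterm i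
    rw [Finset.sum_sub_distrib] at hsum
    simp only [Finset.sum_const, Finset.card_univ, Fintype.card_fin, nsmul_eq_mul] at hsum
    simp only [Set.mem_ofPred_eq]
    linarith
  have hbad : P (⋃ i : Fin n, {x | x i ∈ T}) ≤ ENNReal.ofReal (Real.exp (-(n * (r - ε))) / 2) := by
    have hpT : law μ g T ≤ ENNReal.ofReal (Real.exp (-(κ * n) ^ (1 + η))) := by
      have hlog : Real.log X = κ * n := by rw [hX, Real.log_exp, mul_comm]
      rw [← hlog]
      exact (htail X (by linarith) γ₀ hγ₀).1
    calc P (⋃ i : Fin n, {x | x i ∈ T}) ≤ ∑ i : Fin n, P {x | x i ∈ T} := measure_iUnion_fintype_le _ _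
      _ ≤ ∑ _i : Fin n, law μ g T := Finset.sum_le_sum fun i _ => pi_eval_preimage_le _ i T
      _ = ENNReal.ofReal n * law μ g T := by simp
      _ ≤ ENNReal.ofReal n * ENNReal.ofReal (Real.exp (-(κ * n) ^ (1 + η))) := by gcongr
      _ = ENNReal.ofReal (n * Real.exp (-(κ * n) ^ (1 + η))) := by
        rw [ENNReal.ofReal_mul (by positivity)]
      _ ≤ _ := by
        refine ENNReal.ofReal_le_ofReal ?_
        have h1 : (n : ℝ) ≤ Real.exp n / 2 := by
          have h3 : Real.exp n = Real.exp (n - 1) * Real.exp 1 := by rw [← Real.exp_add]; ring_nf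
          have h4 := Real.add_one_le_exp ((n : ℝ) - 1)
          have := Real.exp_one_gt_d9
          rw [h3]; nlinarith
        calc n * Real.exp (-(κ * n) ^ (1 + η))
            ≤ Real.exp n / 2 * Real.exp (-((r - ε + 2) * n)) := by gcongr
          _ = Real.exp (-(n * (r - ε)) + -n) / 2 := by
            rw [div_mul_eq_mul_div, ← Real.exp_add]; congr 2; ring
          _ ≤ _ := by gcongr; linarith
  have hgood : P (⋃ a ∈ t, {x | -1 ≤ ∑ i, llr g (h a) (x i)})
      ≤ ENNReal.ofReal (Real.exp (-(n * (r - ε))) / 2) := by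
    have hone : ∀ a ∈ t, P {x | -1 ≤ ∑ i, llr g (h a) (x i)}
        ≤ ENNReal.ofReal (Real.exp 1 * Real.exp (-(n * r))) := by
      intro a ha
      obtain ⟨z, hz, hzM⟩ := hr a (htΓ a ha)
      refine (pi_sum_ge_le (law μ g) (hm a (htΓ a ha)) hz.1.le 1).trans ?_
      rw [ENNReal.ofReal_mul (Real.exp_nonneg _)]
      refine mul_le_mul' (ENNReal.ofReal_le_ofReal (Real.exp_le_exp.2 (by linarith [hz.2]))) ?_
      calc _ ≤ ENNReal.ofReal (Real.exp (-r)) ^ n := by gcongr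
        _ = _ := by
          rw [← ENNReal.ofReal_pow (Real.exp_nonneg _), ← Real.exp_nat_mul, mul_neg]
    calc P (⋃ a ∈ t, {x | -1 ≤ ∑ i, llr g (h a) (x i)})
        ≤ ∑ a ∈ t, P {x | -1 ≤ ∑ i, llr g (h a) (x i)} := measure_biUnion_finset_le _ _
      _ ≤ ∑ _a ∈ t, ENNReal.ofReal (Real.exp 1 * Real.exp (-(n * r))) := Finset.sum_le_sum hone
      _ = ENNReal.ofReal (t.card * (Real.exp 1 * Real.exp (-(n * r)))) := by
        rw [ENNReal.ofReal_mul (Nat.cast_nonneg _), Finset.sum_const, nsmul_eq_mul,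
          ENNReal.ofReal_natCast]
      _ ≤ _ := by
        refine ENNReal.ofReal_le_ofReal ?_
        have hδd : δ⁻¹ ^ d ≤ Real.exp (n * (ε / 2)) := by
          rw [hδ, ← Real.exp_neg, neg_neg, ← Real.exp_nat_mul]
          refine Real.exp_le_exp.2 ?_
          nlinarith
        have h3 : Real.exp (-(n * (r - ε))) = Real.exp (n * (ε / 2)) * Real.exp (n * (ε / 2)) *
            Real.exp (-(n * r)) := by
          rw [← Real.exp_add, ← Real.exp_add]; congr 1; ring
        calc t.card * (Real.exp 1 * Real.exp (-(n * r)))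
            ≤ A * Real.exp (n * (ε / 2)) * (Real.exp 1 * Real.exp (-(n * r))) := by
              gcongr
              exact htcard.trans (by gcongr)
          _ = (2 * (A * Real.exp 1)) * (Real.exp (n * (ε / 2)) * Real.exp (-(n * r))) / 2 := by ring
          _ ≤ Real.exp (n * (ε / 2)) * (Real.exp (n * (ε / 2)) * Real.exp (-(n * r))) / 2 := by gcongr
          _ = _ := by rw [h3]; ring
  calc P (rejectionRegion g h Γ 1 n) ≤ P ((⋃ i : Fin n, {x | x i ∈ T}) ∪
        ⋃ a ∈ t, {x | -1 ≤ ∑ i, llr g (h a) (x i)}) := measure_mono_ae hae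
    _ ≤ _ := measure_union_le _ _
    _ ≤ ENNReal.ofReal (Real.exp (-(n * (r - ε))) / 2) +
        ENNReal.ofReal (Real.exp (-(n * (r - ε))) / 2) := add_le_add hbad hgood
    _ = _ := by rw [← ENNReal.ofReal_add (by positivity) (by positivity), add_halves]

end TypeOne

end SeparateFamilies

namespace SeparateFamilies

open ProbabilityTheory

theorem isEquivalent_neg_mul {a : ℕ → ℝ} {ρ : ℝ} (hρ : 0 < ρ)
    (hl : ∀ ε > 0, ∀ᶠ n : ℕ in atTop, -(n * (ρ + ε)) ≤ a n)
    (hu : ∀ ε > 0, ∀ᶠ n : ℕ in atTop, a n ≤ -(n * (ρ - ε))) :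
    a ~[atTop] fun n : ℕ => -((n : ℝ) * ρ) := by
  refine isLittleO_iff.2 fun c hc => ?_
  filter_upwards [hl (c * ρ) (by positivity), hu (c * ρ) (by positivity)] with n h1 h2
  have hn : (0 : ℝ) ≤ n := Nat.cast_nonneg n
  rw [Pi.sub_apply, Real.norm_eq_abs, norm_neg, Real.norm_eq_abs,
    abs_of_nonneg (mul_nonneg hn hρ.le), abs_le]
  constructor <;> linarith

section SimpleHypotheses

variable {μ : Measure ℝ} {g h : ℝ → ℝ} [IsProbabilityMeasure (law μ g)]
  [IsProbabilityMeasure (law μ h)]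

theorem chernoffIndex_pos (H : IsLogRatio (law μ g) (law μ h) (llr g h))
    (hne : ¬ llr g h =ᵐ[law μ g] 0) : 0 < chernoffIndex μ g h := by
  rw [chernoffIndex_eq H hne]
  refine lt_of_lt_of_le ?_ (le_iSup₂ (f := fun z (_ : z ∈ Set.Ioo (0 : ℝ) 1) =>
    -ENNReal.log (expMoment (law μ g) (llr g h) z)) (1 / 2) ⟨by norm_num, by norm_num⟩)
  rw [EReal.lt_neg_comm, neg_zero, ENNReal.log_lt_zero_iff]
  exact H.expMoment_half_lt_one hne

theorem chernoffIndex_lt_top (H : IsLogRatio (law μ g) (law μ h) (llr g h))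
    (hne : ¬ llr g h =ᵐ[law μ g] 0) : chernoffIndex μ g h < ⊤ := by
  obtain ⟨c, hc⟩ := H.exists_pos_le_expMoment
  refine lt_of_le_of_lt ?_ (EReal.coe_lt_top c)
  rw [chernoffIndex_eq H hne]
  refine iSup₂_le fun z hz => ?_
  rw [EReal.neg_le, ← EReal.coe_neg, ← log_ofReal_exp]
  exact ENNReal.log_le_log (hc z hz)

theorem exists_expMoment_le_of_lt_chernoffIndex (H : IsLogRatio (law μ g) (law μ h) (llr g h))
    (hne : ¬ llr g h =ᵐ[law μ g] 0) {r : ℝ} (hr : (r : EReal) < chernoffIndex μ g h) :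
    ∃ z ∈ Set.Ioo (0 : ℝ) 1,
      expMoment (law μ g) (llr g h) z ≤ ENNReal.ofReal (Real.exp (-r)) := by
  rw [chernoffIndex_eq H hne] at hr
  simp only [lt_iSup_iff] at hr
  obtain ⟨z, hz, hlt⟩ := hr
  refine ⟨z, hz, ?_⟩
  rw [← ENNReal.log_le_log_iff, log_ofReal_exp, EReal.coe_neg]
  exact (EReal.lt_neg_comm.1 hlt).le

theorem neg_le_cgf_of_chernoffIndex_le (H : IsLogRatio (law μ g) (law μ h) (llr g h))
    (hne : ¬ llr g h =ᵐ[law μ g] 0) {ρ : ℝ} (hρ : chernoffIndex μ g h ≤ ρ) {z : ℝ}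
    (hz : z ∈ Set.Ioo (0 : ℝ) 1) : -ρ ≤ cgf (llr g h) (law μ g) z := by
  have h1 := (le_iSup₂ (f := fun z (_ : z ∈ Set.Ioo (0 : ℝ) 1) =>
    -ENNReal.log (expMoment (law μ g) (llr g h) z)) z hz).trans
      ((chernoffIndex_eq H hne).symm.le.trans hρ)
  rw [H.expMoment_eq_exp_cgf (Set.Ioo_subset_Icc_self hz), log_ofReal_exp, ← EReal.coe_neg,
    EReal.coe_le_coe_iff] at h1
  linarith

/-- Lower bound for the probability under `g` that the likelihood ratio favours `h`. -/
theorem eventually_le_sampleLaw_sum_pos (H : IsLogRatio (law μ g) (law μ h) (llr g h))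
    (hne : ¬ llr g h =ᵐ[law μ g] 0) {ρ : ℝ} (hρ : chernoffIndex μ g h ≤ ρ) {ε : ℝ} (hε : 0 < ε) :
    ∀ᶠ n : ℕ in atTop, ENNReal.ofReal (Real.exp (-(n * (ρ + ε))))
      ≤ sampleLaw μ g n {x | 0 < ∑ i, llr g h (x i)} := by
  obtain ⟨c, hc, hex⟩ := H.exists_deriv_cgf_eq hne
  set δ := min (c / 2) (ε / 4) with hδ
  have hδ0 : 0 < δ := by positivity
  have hδc : δ ≤ c / 2 := min_le_left _ _
  have hδε : δ ≤ ε / 4 := min_le_right _ _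
  obtain ⟨z, hz, hzδ⟩ := hex δ (by rw [abs_of_pos hδ0]; linarith)
  have hcgf := neg_le_cgf_of_chernoffIndex_le H hne hρ hz
  filter_upwards [H.eventually_le_pi_window hz hδ0, eventually_le_exp_mul 2 (half_pos hε)]
    with n hn hn2
  rw [hzδ] at hn
  refine le_trans (ENNReal.ofReal_le_ofReal ?_) (hn.trans (measure_mono fun x hx => ?_))
  · have hnn : (0 : ℝ) ≤ n := Nat.cast_nonneg n
    rw [le_div_iff₀ two_pos]
    calc Real.exp (-(n * (ρ + ε))) * 2
        ≤ Real.exp (-(n * (ρ + ε))) * Real.exp (n * (ε / 2)) := by gcongr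
      _ = Real.exp (n * (-ρ - ε / 2)) := by rw [← Real.exp_add]; congr 1; ring
      _ ≤ _ := by
        gcongr
        nlinarith [hz.1, hz.2]
  · have := (abs_lt.1 (show |∑ i, llr g h (x i) - n * δ| < n * δ from hx)).1
    change 0 < ∑ i, llr g h (x i)
    linarith

/-- A region whose probability under `g` decays at least at the rate `ρ` has a complement whose
probability under `h` decays at most at that rate. -/
theorem eventually_le_sampleLaw_compl (H : IsLogRatio (law μ g) (law μ h) (llr g h))
    (hne : ¬ llr g h =ᵐ[law μ g] 0) {ρ : ℝ} (hρ : chernoffIndex μ g h ≤ ρ)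
    {R : ∀ n : ℕ, Set (Fin n → ℝ)}
    (hR : ∀ ε > 0, ∀ᶠ n : ℕ in atTop,
      sampleLaw μ g n (R n) ≤ ENNReal.ofReal (Real.exp (-(n * (ρ - ε)))))
    {ε : ℝ} (hε : 0 < ε) :
    ∀ᶠ n : ℕ in atTop, ENNReal.ofReal (Real.exp (-(n * (ρ + ε)))) ≤ sampleLaw μ h n (R n)ᶜ := by
  obtain ⟨c, hc, hex⟩ := H.exists_deriv_cgf_eq hne
  set δ := min (c / 2) (ε / 2) with hδ
  have hδ0 : 0 < δ := by positivity
  have hδc : δ ≤ c / 2 := min_le_left _ _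
  have hδε : δ ≤ ε / 2 := min_le_right _ _
  obtain ⟨z, hz, hzδ⟩ := hex (-δ) (by rw [abs_neg, abs_of_pos hδ0]; linarith)
  have hcgf := neg_le_cgf_of_chernoffIndex_le H hne hρ hz
  have hθ : 0 < z * δ / 4 := by have := hz.1; positivity
  filter_upwards [H.eventually_le_pi_window hz (half_pos hδ0), hR _ hθ, eventually_le_exp_mul 3 hθ]
    with n hW hRn hn3
  have hnn : (0 : ℝ) ≤ n := Nat.cast_nonneg n
  rw [hzδ] at hW
  set W := {x : Fin n → ℝ | |∑ i, llr g h (x i) - n * -δ| < n * (δ / 2)} with hWdef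
  have hdiff : ENNReal.ofReal (Real.exp (-(n * ρ))) ≤ sampleLaw μ g n (W \ R n) := by
    refine le_trans ?_ (le_measure_sdiff (μ := sampleLaw μ g n) (s₁ := W) (s₂ := R n))
    refine le_trans ?_ (tsub_le_tsub hW hRn)
    rw [← ENNReal.ofReal_sub _ (Real.exp_nonneg _)]
    refine ENNReal.ofReal_le_ofReal ?_
    set u := Real.exp (n * (z * δ / 4)) with hu
    have e1 : Real.exp (-(n * (ρ - z * δ / 4))) = Real.exp (-(n * ρ)) * u := by
      rw [hu, ← Real.exp_add]; congr 1; ring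
    have e2 : Real.exp (-(n * ρ)) * (u * u)
        ≤ Real.exp (n * (cgf (llr g h) (law μ g) z - z * (-δ + δ / 2))) := by
      rw [hu, ← Real.exp_add, ← Real.exp_add]
      refine Real.exp_le_exp.2 ?_
      nlinarith [mul_le_mul_of_nonneg_left hcgf hnn]
    rw [e1]
    have h3 : 1 ≤ u * u / 2 - u := by nlinarith
    have := mul_le_mul_of_nonneg_left h3 (Real.exp_nonneg (-(n * ρ)))
    linarith
  calc ENNReal.ofReal (Real.exp (-(n * (ρ + ε))))
      ≤ ENNReal.ofReal (Real.exp (-(n * (3 / 2 * δ))) * Real.exp (-(n * ρ))) := by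
        refine ENNReal.ofReal_le_ofReal ?_
        rw [← Real.exp_add]
        refine Real.exp_le_exp.2 ?_
        nlinarith
    _ = ENNReal.ofReal (Real.exp (-(n * (3 / 2 * δ)))) * ENNReal.ofReal (Real.exp (-(n * ρ))) :=
        ENNReal.ofReal_mul (Real.exp_nonneg _)
    _ ≤ ENNReal.ofReal (Real.exp (-(n * (3 / 2 * δ)))) * sampleLaw μ g n (W \ R n) := by gcongr
    _ ≤ sampleLaw μ h n (W \ R n) := by
        refine H.mul_pi_le fun x hx => ?_
        have := (abs_lt.1 (show |∑ i, llr g h (x i) - n * -δ| < n * (δ / 2) from hx.1)).1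
        linarith
    _ ≤ _ := measure_mono fun x hx => hx.2

/-- Upper bound for the probability under `h` that the likelihood ratio does not favour `h`. -/
theorem sampleLaw_sum_nonpos_le (H : IsLogRatio (law μ g) (law μ h) (llr g h))
    (hne : ¬ llr g h =ᵐ[law μ g] 0) {r : ℝ} (hr : (r : EReal) < chernoffIndex μ g h) (n : ℕ) :
    sampleLaw μ h n {x | ∑ i, llr g h (x i) ≤ 0} ≤ ENNReal.ofReal (Real.exp (-(n * r))) := by
  obtain ⟨z, hz, hzM⟩ := exists_expMoment_le_of_lt_chernoffIndex H hne hr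
  have h1 := pi_sum_ge_le (n := n) (law μ h) H.symm.measurable (z := 1 - z)
    (by linarith [hz.2]) 0
  rw [H.expMoment_symm, sub_sub_cancel, mul_zero, Real.exp_zero, ENNReal.ofReal_one, one_mul] at h1
  refine le_trans (measure_mono fun x hx => ?_) (h1.trans ?_)
  · have hx' : ∑ i, llr g h (x i) ≤ 0 := hx
    change -0 ≤ ∑ i, -llr g h (x i)
    rw [Finset.sum_neg_distrib]
    linarith
  · calc _ ≤ ENNReal.ofReal (Real.exp (-r)) ^ n := by gcongr
      _ = _ := by rw [← ENNReal.ofReal_pow (Real.exp_nonneg _), ← Real.exp_nat_mul, mul_neg]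

end SimpleHypotheses

theorem lowerSemicontinuousOn_chernoffIndex {d : ℕ} {μ : Measure ℝ} {g : ℝ → ℝ}
    {h : EuclideanSpace ℝ (Fin d) → ℝ → ℝ} {Γ : Set (EuclideanSpace ℝ (Fin d))}
    (hg : IsDensity μ g) (hh : ∀ γ ∈ Γ, IsDensity μ (h γ))
    (H : ∀ γ ∈ Γ, IsLogRatio (law μ g) (law μ (h γ)) (llr g (h γ)))
    (hA1 : CompleteSeparation μ g h Γ) (hA3 : GradientTail μ g h Γ) :
    LowerSemicontinuousOn (fun γ => chernoffIndex μ g (h γ)) Γ := by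
  have := hg.isProbabilityMeasure_law
  have hprob : ∀ γ : Γ, IsProbabilityMeasure (law μ (h γ)) := fun γ =>
    (hh γ γ.2).isProbabilityMeasure_law
  rw [← lowerSemicontinuous_restrict_iff]
  have e : Γ.domRestrict (fun γ => chernoffIndex μ g (h γ)) = fun γ : Γ =>
      ⨆ z ∈ Set.Ioo (0 : ℝ) 1, -ENNReal.log (expMoment (law μ g) (llr g (h γ)) z) :=
    funext fun γ => chernoffIndex_eq (H γ γ.2) (hA1.not_ae_zero γ.2)
  rw [e]
  refine lowerSemicontinuous_biSup fun z hz => lowerSemicontinuous_neg_log_expMoment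
    (q := fun γ : Γ => law μ (h γ)) (l := fun γ : Γ => llr g (h γ)) (fun γ => H γ γ.2) ?_ hz
  filter_upwards [hA3.1] with x hx
  exact continuousOn_iff_continuous_domRestrict.1 hx.2.continuousOn

end SeparateFamilies

namespace SeparateFamilies

section Asymptotics

variable {d : ℕ} {μ : Measure ℝ} {g : ℝ → ℝ} {h : EuclideanSpace ℝ (Fin d) → ℝ → ℝ}
  {Γ : Set (EuclideanSpace ℝ (Fin d))} {ρ : ℝ}

theorem isEquivalent_log_sampleLaw_rejectionRegion (hg : IsDensity μ g)
    (hA3 : GradientTail μ g h Γ) (hΓc : IsCompact Γ) (hρ0 : 0 < ρ)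
    {γs : EuclideanSpace ℝ (Fin d)} (hγs : γs ∈ Γ) (hhs : IsDensity μ (h γs))
    (H : IsLogRatio (law μ g) (law μ (h γs)) (llr g (h γs)))
    (hne : ¬ llr g (h γs) =ᵐ[law μ g] 0) (hρ : chernoffIndex μ g (h γs) ≤ ρ)
    (hup : ∀ ε > 0, ∀ᶠ n : ℕ in atTop, sampleLaw μ g n (rejectionRegion g h Γ 1 n)
      ≤ ENNReal.ofReal (Real.exp (-(n * (ρ - ε))))) :
    (fun n : ℕ => Real.log ((sampleLaw μ g n).real (rejectionRegion g h Γ 1 n))) ~[atTop]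
      fun n : ℕ => -((n : ℝ) * ρ) := by
  have := hg.isProbabilityMeasure_law
  have := hhs.isProbabilityMeasure_law
  have hlow : ∀ ε > 0, ∀ᶠ n : ℕ in atTop, Real.exp (-(n * (ρ + ε)))
      ≤ (sampleLaw μ g n).real (rejectionRegion g h Γ 1 n) := by
    intro ε hε
    filter_upwards [eventually_le_sampleLaw_sum_pos H hne hρ hε] with n hn
    have : IsProbabilityMeasure (sampleLaw μ g n) := by unfold sampleLaw; infer_instance
    rw [Measure.real, ← ENNReal.ofReal_le_iff_le_toReal (measure_ne_top _ _)]
    refine hn.trans (measure_mono_ae ?_)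
    filter_upwards [ae_mem_rejectionRegion_iff hg ⟨γs, hγs⟩ hΓc hA3 n] with x hx hpos
    exact hx.2 ⟨γs, hγs, hpos⟩
  refine isEquivalent_neg_mul hρ0 (fun ε hε => ?_) fun ε hε => ?_
  · filter_upwards [hlow ε hε] with n hn
    exact (Real.le_log_iff_exp_le ((Real.exp_pos _).trans_le hn)).2 hn
  · filter_upwards [hlow 1 one_pos, hup ε hε] with n hn1 hn2
    refine (Real.log_le_iff_le_exp ((Real.exp_pos _).trans_le hn1)).2 ?_
    exact ENNReal.toReal_le_of_le_ofReal (Real.exp_nonneg _) hn2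

theorem isEquivalent_iSup_log_sampleLaw_compl (hg : IsDensity μ g)
    (hh : ∀ γ ∈ Γ, IsDensity μ (h γ))
    (H : ∀ γ ∈ Γ, IsLogRatio (law μ g) (law μ (h γ)) (llr g (h γ)))
    (hne : ∀ γ ∈ Γ, ¬ llr g (h γ) =ᵐ[law μ g] 0) (hA3 : GradientTail μ g h Γ)
    (hΓc : IsCompact Γ) (hρ0 : 0 < ρ) {γs : EuclideanSpace ℝ (Fin d)} (hγs : γs ∈ Γ)
    (hρ : chernoffIndex μ g (h γs) ≤ ρ)
    (hlt : ∀ γ ∈ Γ, ∀ r < ρ, (r : EReal) < chernoffIndex μ g (h γ))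
    (hup : ∀ ε > 0, ∀ᶠ n : ℕ in atTop, sampleLaw μ g n (rejectionRegion g h Γ 1 n)
      ≤ ENNReal.ofReal (Real.exp (-(n * (ρ - ε))))) :
    (fun n : ℕ => ⨆ γ : Γ, Real.log ((sampleLaw μ (h γ) n).real (rejectionRegion g h Γ 1 n)ᶜ))
      ~[atTop] fun n : ℕ => -((n : ℝ) * ρ) := by
  have := hg.isProbabilityMeasure_law
  have hhp : ∀ γ : Γ, IsProbabilityMeasure (law μ (h γ)) := fun γ =>
    (hh γ γ.2).isProbabilityMeasure_law
  have hgn : ∀ n, IsProbabilityMeasure (sampleLaw μ g n) := fun n => by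
    unfold sampleLaw; infer_instance
  have hhn : ∀ (γ : Γ) n, IsProbabilityMeasure (sampleLaw μ (h γ) n) := fun γ n => by
    unfold sampleLaw; infer_instance
  have : Nonempty Γ := ⟨⟨γs, hγs⟩⟩
  have hpos : ∀ᶠ n : ℕ in atTop, ∀ γ : Γ,
      0 < (sampleLaw μ (h γ) n).real (rejectionRegion g h Γ 1 n)ᶜ := by
    filter_upwards [hup (ρ / 2) (by positivity), eventually_ge_atTop 1] with n hn hn1 γ
    rw [Measure.real, ENNReal.toReal_pos_iff]
    refine ⟨pos_iff_ne_zero.2 fun h0 => ?_, measure_lt_top _ _⟩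
    have h0' : sampleLaw μ g n (rejectionRegion g h Γ 1 n)ᶜ = 0 :=
      (H γ γ.2).symm.pi_absolutelyContinuous n h0
    have hone : (1 : ℝ≥0∞) ≤ sampleLaw μ g n (rejectionRegion g h Γ 1 n) := by
      rw [← measure_univ (μ := sampleLaw μ g n), ← Set.union_compl_self (rejectionRegion g h Γ 1 n)]
      refine (measure_union_le _ _).trans ?_
      rw [h0', add_zero]
    refine absurd (hone.trans hn) (not_le.2 ?_)
    rw [ENNReal.ofReal_lt_one, Real.exp_lt_one_iff]
    have : (1 : ℝ) ≤ n := by exact_mod_cast hn1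
    nlinarith
  have hbdd : ∀ n : ℕ, BddAbove (Set.range fun γ : Γ =>
      Real.log ((sampleLaw μ (h γ) n).real (rejectionRegion g h Γ 1 n)ᶜ)) := fun n => by
    refine ⟨0, ?_⟩
    rintro _ ⟨γ, rfl⟩
    exact Real.log_nonpos measureReal_nonneg measureReal_le_one
  refine isEquivalent_neg_mul hρ0 (fun ε hε => ?_) fun ε hε => ?_
  · have hhps := hhp ⟨γs, hγs⟩
    filter_upwards [hpos, eventually_le_sampleLaw_compl (H γs hγs) (hne γs hγs) hρ hup hε]
      with n hn1 hn2
    refine le_trans ?_ (le_ciSup (hbdd n) ⟨γs, hγs⟩)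
    refine (Real.le_log_iff_exp_le (hn1 ⟨γs, hγs⟩)).2 ?_
    have := hhn ⟨γs, hγs⟩ n
    exact (ENNReal.ofReal_le_iff_le_toReal (measure_ne_top _ _)).1 hn2
  · filter_upwards [hpos] with n hn
    refine ciSup_le fun γ => (Real.log_le_iff_le_exp (hn γ)).2 ?_
    refine ENNReal.toReal_le_of_le_ofReal (Real.exp_nonneg _) ?_
    refine le_trans (measure_mono_ae ?_)
      (sampleLaw_sum_nonpos_le (H γ γ.2) (hne γ γ.2) (hlt γ γ.2 (ρ - ε) (by linarith)) n)
    filter_upwards [((H γ γ.2).pi_absolutelyContinuous n).ae_le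
      (ae_mem_rejectionRegion_iff hg ⟨γs, hγs⟩ hΓc hA3 n)] with x hx hxc
    by_contra hcon
    exact hxc (hx.2 ⟨γ, γ.2, not_le.1 hcon⟩)

end Asymptotics

end SeparateFamilies

open SeparateFamilies

theorem lemma1 {d : ℕ} (μ : Measure ℝ) (g : ℝ → ℝ)
    (h : EuclideanSpace ℝ (Fin d) → ℝ → ℝ) (Γ : Set (EuclideanSpace ℝ (Fin d)))
    (hg : SeparateFamilies.IsDensity μ g)
    (hh : ∀ γ ∈ Γ, SeparateFamilies.IsDensity μ (h γ))
    (hac : ∀ γ ∈ Γ, SeparateFamilies.law μ g ≪ SeparateFamilies.law μ (h γ) ∧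
      SeparateFamilies.law μ (h γ) ≪ SeparateFamilies.law μ g)
    (hA1 : SeparateFamilies.CompleteSeparation μ g h Γ)
    (hΓne : Γ.Nonempty) (hΓc : IsCompact Γ) (hΓb : SeparateFamilies.HasC1Boundary Γ)
    (hA3 : SeparateFamilies.GradientTail μ g h Γ) :
    ∃ ρ : ℝ, 0 < ρ ∧
      IsLeast ((fun γ => SeparateFamilies.chernoffIndex μ g (h γ)) '' Γ) (ρ : EReal) ∧
      (fun n : ℕ => Real.log ((SeparateFamilies.sampleLaw μ g n).real
          (SeparateFamilies.rejectionRegion g h Γ 1 n))) ~[atTop]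
        (fun n : ℕ => ⨆ γ : Γ, Real.log ((SeparateFamilies.sampleLaw μ (h γ) n).real
          (SeparateFamilies.rejectionRegion g h Γ 1 n)ᶜ)) ∧
      (fun n : ℕ => ⨆ γ : Γ, Real.log ((SeparateFamilies.sampleLaw μ (h γ) n).real
          (SeparateFamilies.rejectionRegion g h Γ 1 n)ᶜ)) ~[atTop]
        (fun n : ℕ => -((n : ℝ) * ρ)) := by
  have hgp := hg.isProbabilityMeasure_law
  have H : ∀ γ ∈ Γ, IsLogRatio (law μ g) (law μ (h γ)) (llr g (h γ)) := fun γ hγ =>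
    hg.isLogRatio (hh γ hγ) (hac γ hγ).1 (hac γ hγ).2
  have hne := fun γ (hγ : γ ∈ Γ) => hA1.not_ae_zero hγ
  obtain ⟨γs, hγs, hmin⟩ := (lowerSemicontinuousOn_chernoffIndex hg hh H hA1 hA3).exists_isMinOn
    hΓne hΓc
  have hps := (hh γs hγs).isProbabilityMeasure_law
  obtain ⟨ρ, hρ⟩ : ∃ ρ : ℝ, chernoffIndex μ g (h γs) = ρ :=
    ⟨_, (EReal.coe_toReal (chernoffIndex_lt_top (H γs hγs) (hne γs hγs)).ne
      (EReal.bot_lt_zero.trans (chernoffIndex_pos (H γs hγs) (hne γs hγs))).ne').symm⟩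
  have hρ0 : 0 < ρ := by
    have := chernoffIndex_pos (H γs hγs) (hne γs hγs)
    rw [hρ] at this
    exact_mod_cast this
  have hlt : ∀ γ ∈ Γ, ∀ r < ρ, (r : EReal) < chernoffIndex μ g (h γ) := fun γ hγ r hr =>
    lt_of_lt_of_le ((EReal.coe_lt_coe_iff.2 hr).trans_eq hρ.symm) (hmin hγ)
  have hup : ∀ ε > 0, ∀ᶠ n : ℕ in atTop, sampleLaw μ g n (rejectionRegion g h Γ 1 n)
      ≤ ENNReal.ofReal (Real.exp (-(n * (ρ - ε)))) := by
    intro ε hε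
    have := eventually_sampleLaw_rejectionRegion_le hg (fun γ hγ => (H γ hγ).measurable) hΓne hΓc
      hΓb hA3 (r := ρ - ε / 2) (fun γ hγ => by
        have := (hh γ hγ).isProbabilityMeasure_law
        exact exists_expMoment_le_of_lt_chernoffIndex (H γ hγ) (hne γ hγ)
          (hlt γ hγ _ (by linarith))) (half_pos hε)
    simpa only [sub_sub, add_halves] using this
  have hII := isEquivalent_iSup_log_sampleLaw_compl hg hh H hne hA3 hΓc hρ0 hγs hρ.le hlt hup
  have hI := isEquivalent_log_sampleLaw_rejectionRegion hg hA3 hΓc hρ0 hγs (hh γs hγs) (H γs hγs)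
    (hne γs hγs) hρ.le hup
  refine ⟨ρ, hρ0, ⟨⟨γs, hγs, hρ⟩, ?_⟩, hI.trans hII.symm, hII⟩
  · rintro _ ⟨γ, hγ, rfl⟩
    rw [← hρ]
    exact hmin hγ
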